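/- Let $d\ge 1$, let $m\ge 2$ be a real number, let $(\Omega,\mathcal F,\mathbb P)$ be a complete probability space with a filtration $(\mathcal F_t)_{t\ge 0}$ such that $\mathcal F_0$ contains all $\mathbb P$-null sets, and let $0\le S<T$. Write $\mathbb E^{\mathcal F_s}$ for the conditional expectation given $\mathcal F_s$ and $\|X\|_{L_m}=(\mathbb E|X|^m)^{1/m}$ for random vectors $X$ in $\mathbb R^d$, with $|\cdot|$ the Euclidean norm. Let $\kappa_{m,d}$ be the constant in the (discrete-time) Burkholder–Davis–Gundy inequality in $L_m$, i.e. the least $\kappa\ge 0$ such that $$\|M_n\|_{L_m}\le \kappa\,\Big\|\Big(\sum_{i=0}^{n-1}|M_{i+1}-M_i|^2\Big)^{1/2}\Big\|_{L_m}$$ for every $n\ge 0$ and every $L_m$-integrable $\mathbb R^d$-valued discrete-time martingale $(M_i)_{i\ge 0}$ with $M_0=0$, on any probability space and for any filtration. Let $(A_{s,t})_{S\le s\le t\le T}$ be a two-parameter process with values in $\mathbb R^d$ such that $A_{s,t}$ is $\mathcal F_t$-measurable and belongs to $L_m$ for all $S\le s\le t\le T$, and put $\delta A_{s,u,t}=A_{s,t}-A_{s,u}-A_{u,t}$.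 Assume that there are constants $\Gamma_1,\Gamma_4\ge 0$ and $\varepsilon_1,\varepsilon_4>0$ such that $$\|\mathbb E^{\mathcal F_s}\delta A_{s,u,t}\|_{L_m}\le \Gamma_1|t-s|^{1+\varepsilon_1}\quad\text{for all } S\le s\le u\le t\le T,$$ $$\|A_{s,t}\|_{L_m}\le \Gamma_4|t-s|^{\frac12+\varepsilon_4}\quad\text{for all } S\le s\le t\le T.$$ Then there exists a process $(\mathcal A_t)_{S\le t\le T}$ with values in $\mathbb R^d$, unique up to modifications, with the following two properties: (a) $\mathcal A_S=0$ almost surely, and for every $t\in[S,T]$, $\mathcal A_t$ is $\mathcal F_t$-measurable and belongs to $L_m$; (b) there are constants $C_1,C_4\ge 0$ such that for all $S\le s\le t\le T$ $$\|\mathcal A_t-\mathcal A_s\|_{L_m}\le C_1|t-s|^{1+\varepsilon_1}+C_4|t-s|^{\frac12+\varepsilon_4},$$ $$\|\mathbb E^{\mathcal F_s}(\mathcal A_t-\mathcal A_s-A_{s,t})\|_{L_m}\le C_1|t-s|^{1+\varepsilon_1}.$$ Moreover, the bounds in (b) hold with $C_1=\Gamma_1(1-2^{-\varepsilon_1})^{-1}$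 and $C_4=\Gamma_4\big(6\kappa_{m,d}(1-2^{-\varepsilon_4})^{-1}+1\big)$. -/

import Mathlib

open MeasureTheory ProbabilityTheory
open scoped NNReal ENNReal

universe u

/-- `κ` is an admissible constant in the Burkholder–Davis–Gundy inequality in `L_m` for discrete
time martingales with values in `ℝ^d`: on every probability space, for every filtration and every
`L_m`-integrable martingale `M` with `M 0 = 0`,
`‖M_n‖_{L_m} ≤ κ ‖(∑_{i<n} |M_{i+1} - M_i|²)^{1/2}‖_{L_m}`. -/
def IsBDGConst (m : ℝ) (d : ℕ) (κ : ℝ) : Prop :=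
  0 ≤ κ ∧
  ∀ (Ω : Type u) (mΩ : MeasurableSpace Ω) (P : @Measure Ω mΩ) (_ : IsProbabilityMeasure P)
    (𝓖 : Filtration ℕ mΩ) (M : ℕ → Ω → EuclideanSpace ℝ (Fin d)),
    Martingale M 𝓖 P → M 0 = 0 → (∀ i, MemLp (M i) (ENNReal.ofReal m) P) →
    ∀ n : ℕ,
      eLpNorm (M n) (ENNReal.ofReal m) P ≤
        ENNReal.ofReal κ *
          eLpNorm (fun ω => Real.sqrt (∑ i ∈ Finset.range n, ‖M (i + 1) ω - M i ω‖ ^ 2))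
            (ENNReal.ofReal m) P

/-- The constant `κ_{m,d}` of the Burkholder–Davis–Gundy inequality in `L_m`: the least
admissible one. -/
noncomputable def bdgConst (m : ℝ) (d : ℕ) : ℝ :=
  sInf {κ : ℝ | IsBDGConst.{u} m d κ}

section Sewing

variable {Ω : Type u} {mΩ : MeasurableSpace Ω} {d : ℕ}

/-- `δA_{s,u,t} = A_{s,t} - A_{s,u} - A_{u,t}`. -/
def incr (A : ℝ≥0 → ℝ≥0 → Ω → EuclideanSpace ℝ (Fin d)) (s r t : ℝ≥0) :
    Ω → EuclideanSpace ℝ (Fin d) :=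
  A s t - A s r - A r t

/-- The two bounds
`‖𝒜_t - 𝒜_s‖_{L_m} ≤ C₁ |t - s|^{1 + ε₁} + C₄ |t - s|^{1/2 + ε₄}` and
`‖E^{𝓕_s} (𝒜_t - 𝒜_s - A_{s,t})‖_{L_m} ≤ C₁ |t - s|^{1 + ε₁}` on the simplex
`S ≤ s ≤ t ≤ T`. -/
def SewingBounds (P : Measure Ω) (𝓕 : Filtration ℝ≥0 mΩ) (S T : ℝ≥0) (m ε₁ ε₄ : ℝ)
    (A : ℝ≥0 → ℝ≥0 → Ω → EuclideanSpace ℝ (Fin d)) (C₁ C₄ : ℝ)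
    (φ : ℝ≥0 → Ω → EuclideanSpace ℝ (Fin d)) : Prop :=
  ∀ s t : ℝ≥0, S ≤ s → s ≤ t → t ≤ T →
    eLpNorm (φ t - φ s) (ENNReal.ofReal m) P ≤
        ENNReal.ofReal (C₁ * |(t : ℝ) - s| ^ (1 + ε₁) + C₄ * |(t : ℝ) - s| ^ (1 / 2 + ε₄)) ∧
      eLpNorm (P[φ t - φ s - A s t | 𝓕 s]) (ENNReal.ofReal m) P ≤
        ENNReal.ofReal (C₁ * |(t : ℝ) - s| ^ (1 + ε₁))

/-- The process `(φ_t)_{S ≤ t ≤ T}` vanishes at `S`, is adapted and `L_m`-integrable, and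
satisfies the two bounds above for some non-negative constants. -/
structure IsSewing (P : Measure Ω) (𝓕 : Filtration ℝ≥0 mΩ) (S T : ℝ≥0) (m ε₁ ε₄ : ℝ)
    (A : ℝ≥0 → ℝ≥0 → Ω → EuclideanSpace ℝ (Fin d))
    (φ : ℝ≥0 → Ω → EuclideanSpace ℝ (Fin d)) : Prop where
  zero : φ S =ᵐ[P] 0
  adapted : ∀ t, S ≤ t → t ≤ T → StronglyMeasurable[𝓕 t] (φ t)
  memLp : ∀ t, S ≤ t → t ≤ T → MemLp (φ t) (ENNReal.ofReal m) P
  bounds : ∃ C₁ C₄ : ℝ, 0 ≤ C₁ ∧ 0 ≤ C₄ ∧ SewingBounds P 𝓕 S T m ε₁ ε₄ A C₁ C₄ φ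

end Sewing

/-! Sum `A` along dyadic partitions and pass to the limit in L_m. Refining a partition changes the
sum by one term `incr A` per cell. Each term splits into its conditional expectation given the past
and a martingale difference: the former are summed by the triangle inequality, the latter by
Burkholder's inequality, whose square function only asks for a power of the cell length above 1/2
(`eLpNorm_sum_partition_le`). With mesh μ the change is O(μ^ε₁ + μ^ε₄), which is summable over
dyadic levels.

The dyadic grids of different intervals are not nested, so additivity of the limits is not
automatic. All sums are therefore first taken on one grid of [S, T], clamped to [s, t], and φ_t is
the limit over [S, t]. Inserting a point s again costs one `incr` per cell, so the limits are
additive (`tendsto_gridSum_add`). The clamped mesh is at most both t - s and (T - S) 2^{-n}; the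
geometric mean of the two yields bounds on φ_t - φ_s - A_{s,t} with ε₁, ε₄ halved.

These weaker bounds still have exponents above 1 and 1/2, which suffices for
`tendsto_gridSum_of_bounds`: φ_t - φ_s is also the limit along the dyadic grid of [s, t] itself.
There the mesh is (t - s) 2^{-n}, and the geometric series produce the stated constants. The same
lemma identifies the increments of any competitor, hence uniqueness.

Since `bdgConst` is an infimum, it is meaningful only once some admissible constant exists. This
comes from a pathwise inequality bounding the running maximum by the square function plus a
martingale transform of zero mean. -/

/-! ### Pathwise Burkholder inequality for sequences -/

section Pathwise

/-- Young's inequality in the form `c a ^ (p - q) b ^ q ≤ η a ^ p + C b ^ p`. -/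
lemma exists_mul_rpow_mul_rpow_le {p q c η : ℝ} (hq : 1 ≤ q) (hqp : q ≤ p) (hc : 0 ≤ c)
    (hη : 0 < η) :
    ∃ C : ℝ, 0 ≤ C ∧ ∀ a b : ℝ, 0 ≤ a → 0 ≤ b →
      c * (a ^ (p - q) * b ^ q) ≤ η * a ^ p + C * b ^ p := by
  set l : ℝ := min 1 (η / (c + 1)) with hl
  have hl0 : 0 < l := by positivity
  have hl1 : l ≤ 1 := min_le_left _ _
  have hcl : c * l ^ q ≤ η := by
    have h1 : l ^ q ≤ l := by
      simpa using Real.rpow_le_rpow_of_exponent_ge hl0 hl1 hq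
    have h2 : l * (c + 1) ≤ η := by
      rw [← le_div_iff₀ (by positivity)]
      exact min_le_right _ _
    nlinarith
  refine ⟨c / l ^ (p - q), by positivity, fun a b ha hb => ?_⟩
  have hpq : 0 ≤ p - q := by linarith
  have hsplit : ∀ x : ℝ, 0 ≤ x → x ^ (p - q) * x ^ q = x ^ p := fun x hx => by
    rw [← Real.rpow_add_of_nonneg hx hpq (by linarith), sub_add_cancel]
  rcases le_total b (l * a) with h | h
  · have h1 : b ^ q ≤ l ^ q * a ^ q := by
      rw [← Real.mul_rpow hl0.le ha]
      exact Real.rpow_le_rpow hb h (by linarith)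
    calc c * (a ^ (p - q) * b ^ q) ≤ c * (a ^ (p - q) * (l ^ q * a ^ q)) := by gcongr
      _ = (c * l ^ q) * (a ^ (p - q) * a ^ q) := by ring
      _ ≤ η * a ^ p := by rw [hsplit a ha]; gcongr
      _ ≤ η * a ^ p + c / l ^ (p - q) * b ^ p := le_add_of_nonneg_right (by positivity)
  · have h1 : a ^ (p - q) ≤ b ^ (p - q) / l ^ (p - q) := by
      rw [← Real.div_rpow hb hl0.le]
      refine Real.rpow_le_rpow ha ?_ hpq
      rw [le_div_iff₀ hl0]
      linarith
    calc c * (a ^ (p - q) * b ^ q) ≤ c * (b ^ (p - q) / l ^ (p - q) * b ^ q) := by gcongr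
      _ = c / l ^ (p - q) * (b ^ (p - q) * b ^ q) := by ring
      _ = c / l ^ (p - q) * b ^ p := by rw [hsplit b hb]
      _ ≤ η * a ^ p + c / l ^ (p - q) * b ^ p := le_add_of_nonneg_left (by positivity)

/-- The convex function x ^ r lies above its tangent at a; this is Bernoulli's inequality for b / a.
-/
lemma mul_rpow_sub_one_mul_le {r a b : ℝ} (hr : 1 ≤ r) (ha : 0 ≤ a) (hb : 0 ≤ b) :
    r * (a ^ (r - 1) * b) ≤ (r - 1) * a ^ r + b ^ r := by
  rcases ha.eq_or_lt with rfl | ha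
  · rcases hr.eq_or_lt with rfl | hr
    · simp
    · rw [Real.zero_rpow (by linarith), Real.zero_rpow (by linarith)]
      simp only [zero_mul, mul_zero, zero_add]
      positivity
  · have h := one_add_mul_self_le_rpow_one_add (s := b / a - 1) (p := r)
      (by linarith [div_nonneg hb ha.le]) hr
    rw [add_sub_cancel, Real.div_rpow hb ha.le, le_div_iff₀ (by positivity)] at h
    have h2 : a ^ r = a ^ (r - 1) * a := by
      rw [← Real.rpow_add_one ha.ne', sub_add_cancel]
    have h3 : r * (a ^ (r - 1) * b) = r * (b / a) * a ^ r := by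
      rw [h2]; field_simp
    rw [h3]
    linarith

/-- For q < 1 the function x ^ q is not Lipschitz at 0, but the weight b repairs this: the left side
is at most |a ^ (q + 1) - b ^ (q + 1)|, and x ^ (q + 1) has a bounded derivative on [0, c]. -/
lemma abs_rpow_sub_rpow_mul_le {q a b c : ℝ} (hq : 0 ≤ q) (ha : 0 ≤ a) (hb : 0 ≤ b)
    (hac : a ≤ c) (hbc : b ≤ c) :
    |a ^ q - b ^ q| * b ≤ (q + 1) * c ^ q * |a - b| := by
  have key : ∀ x y : ℝ, 0 ≤ x → x ≤ y → y ≤ c →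
      y ^ (q + 1) - x ^ (q + 1) ≤ (q + 1) * c ^ q * (y - x) := fun x y hx hxy hyc => by
    have h := mul_rpow_sub_one_mul_le (r := q + 1) (by linarith) (hx.trans hxy) hx
    rw [add_sub_cancel_right] at h
    have h2 : y ^ (q + 1) = y ^ q * y := by
      rw [Real.rpow_add_of_nonneg (hx.trans hxy) hq zero_le_one, Real.rpow_one]
    have h3 : y ^ q ≤ c ^ q := Real.rpow_le_rpow (hx.trans hxy) hyc hq
    have h4 : (q + 1) * y ^ q * (y - x) ≤ (q + 1) * c ^ q * (y - x) := by
      have := sub_nonneg.2 hxy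
      gcongr
    nlinarith
  have hs : ∀ x : ℝ, 0 ≤ x → x ^ (q + 1) = x ^ q * x := fun x hx => by
    rw [Real.rpow_add_of_nonneg hx hq zero_le_one, Real.rpow_one]
  rcases le_total a b with h | h
  · have h1 : a ^ q ≤ b ^ q := Real.rpow_le_rpow ha h hq
    have h2 := key a b ha h hbc
    rw [abs_of_nonpos (by linarith), abs_of_nonpos (by linarith)]
    have h3 : a ^ q * a ≤ a ^ q * b := by gcongr
    have h4 : (a ^ q) * b ≥ a ^ (q + 1) := by rw [hs a ha]; exact h3
    rw [hs b hb] at h2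
    nlinarith
  · have h1 : b ^ q ≤ a ^ q := Real.rpow_le_rpow hb h hq
    have h2 := key b a hb h hac
    rw [abs_of_nonneg (by linarith), abs_of_nonneg (by linarith)]
    rw [hs a ha, hs b hb] at h2
    have h3 : a ^ q * b ≤ a ^ q * a := by gcongr
    nlinarith

variable {E : Type*} [NormedAddCommGroup E]

/-- The running maximum of the norms of a sequence. -/
noncomputable def runMax (x : ℕ → E) : ℕ → ℝ
  | 0 => ‖x 0‖
  | n + 1 => max (runMax x n) ‖x (n + 1)‖

lemma norm_le_runMax (x : ℕ → E) (n : ℕ) : ‖x n‖ ≤ runMax x n := by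
  cases n with
  | zero => exact le_rfl
  | succ n => exact le_max_right _ _

lemma runMax_nonneg (x : ℕ → E) (n : ℕ) : 0 ≤ runMax x n :=
  (norm_nonneg _).trans (norm_le_runMax x n)

lemma runMax_mono (x : ℕ → E) : Monotone (runMax x) :=
  monotone_nat_of_le_succ fun _ => le_max_left _ _

/-- One step of the pathwise form of Doob's `L^p` inequality. -/
lemma doob_step {p : ℝ} (hp : 2 ≤ p) {a X Y : ℝ} (hY : 0 ≤ Y) (ha : 0 ≤ a) :
    (p - 1) * max a Y ^ p - p * (Y * max a Y ^ (p - 1)) ≤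
      (p - 1) * a ^ p - p * (X * a ^ (p - 1)) - p * (a ^ (p - 1) * (Y - X)) := by
  rcases le_total Y a with h | h
  · rw [max_eq_left h]
    apply le_of_eq
    ring
  · rw [max_eq_right h]
    have h1 := mul_rpow_sub_one_mul_le (r := p) (by linarith) ha hY
    have h2 : Y ^ p = Y * Y ^ (p - 1) := by
      rw [← Real.rpow_one_add' hY (by linarith)]
      congr 1
      ring
    nlinarith

variable [InnerProductSpace ℝ E]

/-- A second-order Taylor bound without second derivatives. Convexity at x + y bounds the difference
by the gradient there paired with y, and the map v ↦ ‖v‖ ^ (p - 2) v is Lipschitz with constant p b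
^ (p - 2) between the two points. -/
lemma norm_add_rpow_le {p b : ℝ} (hp : 2 ≤ p) (x y : E) (hx : ‖x‖ ≤ b) (hxy : ‖x + y‖ ≤ b) :
    ‖x + y‖ ^ p ≤ ‖x‖ ^ p + p * (‖x‖ ^ (p - 2) * inner ℝ x y) +
      p ^ 2 * (b ^ (p - 2) * ‖y‖ ^ 2) := by
  have hb : 0 ≤ b := (norm_nonneg x).trans hx
  set z := x + y with hz
  have hzp : ‖z‖ ^ p = ‖z‖ ^ (p - 2) * ‖z‖ ^ 2 := by
    rw [← Real.rpow_natCast, ← Real.rpow_add_of_nonneg (norm_nonneg _) (by linarith) (by simp)]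
    simp
  have hzp1 : ‖z‖ ^ (p - 1) = ‖z‖ ^ (p - 2) * ‖z‖ := by
    conv_rhs => rw [← Real.rpow_one ‖z‖, ← Real.rpow_mul (norm_nonneg _), one_mul]
    rw [← Real.rpow_add_of_nonneg (norm_nonneg _) (by linarith) (by simp)]
    congr 1
    ring
  have hconv : ‖z‖ ^ p - ‖x‖ ^ p ≤ p * (‖z‖ ^ (p - 2) * inner ℝ z y) := by
    have h1 := mul_rpow_sub_one_mul_le (r := p) (by linarith) (norm_nonneg z) (norm_nonneg x)
    have h2 : inner ℝ z y = ‖z‖ ^ 2 - inner ℝ z x := by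
      have : y = z - x := by simp [hz]
      rw [this, inner_sub_right, real_inner_self_eq_norm_sq]
    have h3 : inner ℝ z x ≤ ‖z‖ * ‖x‖ := real_inner_le_norm z x
    rw [hzp1] at h1
    rw [h2, mul_sub, ← hzp]
    have h4 : ‖z‖ ^ (p - 2) * inner ℝ z x ≤ ‖z‖ ^ (p - 2) * (‖z‖ * ‖x‖) := by gcongr
    nlinarith
  have hgrad : ‖(‖z‖ ^ (p - 2)) • z - (‖x‖ ^ (p - 2)) • x‖ ≤ p * b ^ (p - 2) * ‖y‖ := by
    have h1 : (‖z‖ ^ (p - 2)) • z - (‖x‖ ^ (p - 2)) • x =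
        (‖z‖ ^ (p - 2)) • y + (‖z‖ ^ (p - 2) - ‖x‖ ^ (p - 2)) • x := by
      rw [hz]; module
    have h2 := abs_rpow_sub_rpow_mul_le (q := p - 2) (by linarith) (norm_nonneg z)
      (norm_nonneg x) hxy hx
    have h3 : |‖z‖ - ‖x‖| ≤ ‖y‖ := by
      have := abs_norm_sub_norm_le z x
      simpa [hz] using this
    have h4 : ‖z‖ ^ (p - 2) ≤ b ^ (p - 2) :=
      Real.rpow_le_rpow (norm_nonneg _) hxy (by linarith)
    rw [h1]
    refine (norm_add_le _ _).trans ?_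
    rw [norm_smul, norm_smul, Real.norm_of_nonneg (by positivity), Real.norm_eq_abs]
    calc ‖z‖ ^ (p - 2) * ‖y‖ + |‖z‖ ^ (p - 2) - ‖x‖ ^ (p - 2)| * ‖x‖
        ≤ b ^ (p - 2) * ‖y‖ + (p - 2 + 1) * b ^ (p - 2) * ‖y‖ := by
          refine add_le_add (by gcongr) (h2.trans ?_)
          have : 0 ≤ p - 2 + 1 := by linarith
          gcongr
      _ = p * b ^ (p - 2) * ‖y‖ := by ring
  have hin : ‖z‖ ^ (p - 2) * inner ℝ z y - ‖x‖ ^ (p - 2) * inner ℝ x y ≤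
      p * b ^ (p - 2) * ‖y‖ * ‖y‖ := by
    rw [← real_inner_smul_left, ← real_inner_smul_left, ← inner_sub_left]
    exact (real_inner_le_norm _ _).trans (by gcongr)
  have hp0 : 0 ≤ p := by linarith
  nlinarith [mul_le_mul_of_nonneg_left hin hp0]

/-- The integrand of the martingale transform in the pathwise Burkholder inequality. -/
noncomputable def pathGrad (p α β : ℝ) (x : ℕ → E) (i : ℕ) : E :=
  (α * ‖x i‖ ^ (p - 2)) • x i - (β * runMax x i ^ (p - 1) * ‖x i‖⁻¹) • x i

lemma norm_pathGrad_le {p α β : ℝ} (hp : 2 ≤ p) (hα : 0 ≤ α) (hβ : 0 ≤ β) (x : ℕ → E) (i : ℕ) :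
    ‖pathGrad p α β x i‖ ≤ (α + β) * runMax x i ^ (p - 1) := by
  have hr := runMax_nonneg x i
  have h1 : ‖x i‖ ^ (p - 2) * ‖x i‖ ≤ runMax x i ^ (p - 1) := by
    have : ‖x i‖ ^ (p - 2) * ‖x i‖ = ‖x i‖ ^ (p - 1) := by
      rw [← Real.rpow_add_one' (norm_nonneg _) (by linarith)]
      congr 1
      ring
    rw [this]
    exact Real.rpow_le_rpow (norm_nonneg _) (norm_le_runMax x i) (by linarith)
  have h2 : ‖x i‖⁻¹ * ‖x i‖ ≤ 1 := inv_mul_le_one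
  refine (norm_sub_le _ _).trans ?_
  rw [norm_smul, norm_smul, Real.norm_of_nonneg (by positivity),
    Real.norm_of_nonneg (by positivity), add_mul, mul_assoc, mul_assoc]
  refine add_le_add (by gcongr) ?_
  calc β * runMax x i ^ (p - 1) * (‖x i‖⁻¹ * ‖x i‖) ≤ β * runMax x i ^ (p - 1) * 1 := by gcongr
    _ = _ := mul_one _

lemma doob_pathwise {p : ℝ} (hp : 2 ≤ p) (x : ℕ → E) (hx : x 0 = 0) (n : ℕ) :
    (p - 1) * runMax x n ^ p - p * (‖x n‖ * runMax x n ^ (p - 1)) ≤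
      - ∑ i ∈ Finset.range n, p * (runMax x i ^ (p - 1) * ‖x i‖⁻¹ *
        inner ℝ (x i) (x (i + 1) - x i)) := by
  induction n with
  | zero =>
    simp only [runMax, hx, norm_zero, Finset.range_zero, Finset.sum_empty]
    rw [Real.zero_rpow (by linarith)]
    simp
  | succ n ih =>
    rw [Finset.sum_range_succ]
    have h1 := doob_step (X := ‖x n‖) hp (norm_nonneg (x (n + 1))) (runMax_nonneg x n)
    -- The subgradient inequality for the norm; at `x n = 0` the convention `0⁻¹ = 0` selects the
    -- subgradient 0.
    have hin : ‖x n‖⁻¹ * inner ℝ (x n) (x (n + 1) - x n) ≤ ‖x (n + 1)‖ - ‖x n‖ := by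
      rcases eq_or_ne (x n) 0 with h0 | h0
      · simp [h0]
      · rw [inner_sub_right, real_inner_self_eq_norm_sq, inv_mul_le_iff₀ (norm_pos_iff.2 h0)]
        nlinarith [real_inner_le_norm (x n) (x (n + 1))]
    have h2 : p * (runMax x n ^ (p - 1) * ‖x n‖⁻¹ * inner ℝ (x n) (x (n + 1) - x n)) ≤
        p * (runMax x n ^ (p - 1) * (‖x (n + 1)‖ - ‖x n‖)) := by
      rw [mul_assoc (runMax x n ^ (p - 1))]
      have := Real.rpow_nonneg (runMax_nonneg x n) (p - 1)
      gcongr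
    simp only [runMax]
    linarith

lemma norm_rpow_pathwise {p : ℝ} (hp : 2 ≤ p) (x : ℕ → E) (hx : x 0 = 0) (n : ℕ) :
    ‖x n‖ ^ p ≤ ∑ i ∈ Finset.range n, p * (‖x i‖ ^ (p - 2) * inner ℝ (x i) (x (i + 1) - x i)) +
      p ^ 2 * (runMax x n ^ (p - 2) * ∑ i ∈ Finset.range n, ‖x (i + 1) - x i‖ ^ 2) := by
  induction n with
  | zero =>
    simp [hx, Real.zero_rpow (show p ≠ 0 by linarith)]
  | succ n ih =>
    rw [Finset.sum_range_succ, Finset.sum_range_succ]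
    have h1 := norm_add_rpow_le hp (x n) (x (n + 1) - x n) (b := runMax x (n + 1))
      ((norm_le_runMax x n).trans (runMax_mono x n.le_succ))
      (by rw [add_sub_cancel]; exact norm_le_runMax x (n + 1))
    rw [add_sub_cancel] at h1
    have h2 : runMax x n ^ (p - 2) ≤ runMax x (n + 1) ^ (p - 2) :=
      Real.rpow_le_rpow (runMax_nonneg x n) (runMax_mono x n.le_succ) (by linarith)
    have h3 : p ^ 2 * (runMax x n ^ (p - 2) * ∑ i ∈ Finset.range n, ‖x (i + 1) - x i‖ ^ 2) ≤
        p ^ 2 * (runMax x (n + 1) ^ (p - 2) *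
          ∑ i ∈ Finset.range n, ‖x (i + 1) - x i‖ ^ 2) := by
      gcongr
    nlinarith

/-- A pathwise form of the Burkholder inequality: up to a martingale transform, the running
maximum is controlled by the square function. -/
lemma exists_pathwise_burkholder {p : ℝ} (hp : 2 ≤ p) :
    ∃ C α β : ℝ, 0 ≤ C ∧ 0 ≤ α ∧ 0 ≤ β ∧
      ∀ (E : Type*) [NormedAddCommGroup E] [InnerProductSpace ℝ E] (x : ℕ → E), x 0 = 0 →
        ∀ n, runMax x n ^ p ≤
          C * Real.sqrt (∑ i ∈ Finset.range n, ‖x (i + 1) - x i‖ ^ 2) ^ p +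
            ∑ i ∈ Finset.range n, inner ℝ (pathGrad p α β x i) (x (i + 1) - x i) := by
  -- With R the running maximum, Doob's part leaves at least (p - 3/2) R ^ p ≥ R ^ p / 2 after the
  -- first Young inequality. The second takes another R ^ p / 4, so R ^ p / 4 survives; this
  -- explains the factors 4 below.
  obtain ⟨C₁, hC₁, hY₁⟩ := exists_mul_rpow_mul_rpow_le (p := p) (q := 1) (c := p) (η := 1 / 2)
    le_rfl (by linarith) (by linarith) (by norm_num)
  obtain ⟨C₂, hC₂, hY₂⟩ := exists_mul_rpow_mul_rpow_le (p := p) (q := 2) (c := C₁ * p ^ 2)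
    (η := 1 / 4) (by norm_num) hp (by positivity) (by norm_num)
  have hp0 : 0 ≤ p := by linarith
  refine ⟨4 * C₂, 4 * (C₁ * p), 4 * p, by positivity, by positivity, by positivity,
    fun E _ _ x hx n => ?_⟩
  have h1 := doob_pathwise hp x hx n
  have h2 := norm_rpow_pathwise hp x hx n
  have h3 := hY₁ (runMax x n) ‖x n‖ (runMax_nonneg x n) (norm_nonneg _)
  have hS : Real.sqrt (∑ i ∈ Finset.range n, ‖x (i + 1) - x i‖ ^ 2) ^ (2 : ℝ) =
      ∑ i ∈ Finset.range n, ‖x (i + 1) - x i‖ ^ 2 := by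
    rw [Real.rpow_two, Real.sq_sqrt (Finset.sum_nonneg fun _ _ => by positivity)]
  have h4 := hY₂ (runMax x n) _ (runMax_nonneg x n)
    (Real.sqrt_nonneg (∑ i ∈ Finset.range n, ‖x (i + 1) - x i‖ ^ 2))
  rw [hS] at h4
  rw [Real.rpow_one] at h3
  have hr : 0 ≤ runMax x n ^ p := Real.rpow_nonneg (runMax_nonneg x n) _
  have hsum : ∑ i ∈ Finset.range n,
        inner ℝ (pathGrad p (4 * (C₁ * p)) (4 * p) x i) (x (i + 1) - x i) =
      4 * (C₁ * ∑ i ∈ Finset.range n,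
          p * (‖x i‖ ^ (p - 2) * inner ℝ (x i) (x (i + 1) - x i))) -
        4 * ∑ i ∈ Finset.range n, p * (runMax x i ^ (p - 1) * ‖x i‖⁻¹ *
          inner ℝ (x i) (x (i + 1) - x i)) := by
    rw [Finset.mul_sum, Finset.mul_sum, Finset.mul_sum, ← Finset.sum_sub_distrib]
    refine Finset.sum_congr rfl fun i _ => ?_
    rw [pathGrad, inner_sub_left, real_inner_smul_left, real_inner_smul_left]
    ring
  rw [hsum]
  have h5 := mul_le_mul_of_nonneg_left h2 hC₁
  nlinarith

end Pathwise

/-! ### The Burkholder inequality in L_m and its optimal constant -/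

section Burkholder

variable {Ω : Type*} {mΩ : MeasurableSpace Ω} {P : Measure Ω} {E : Type*} [NormedAddCommGroup E]

lemma stronglyMeasurable_runMax {𝓖 : Filtration ℕ mΩ} {M : ℕ → Ω → E}
    (hM : ∀ i, StronglyMeasurable[𝓖 i] (M i)) (n : ℕ) :
    StronglyMeasurable[𝓖 n] (fun ω => runMax (fun i => M i ω) n) := by
  induction n with
  | zero => exact (hM 0).norm
  | succ n ih => exact ((ih.mono (𝓖.mono n.le_succ)).measurable.max
    (hM (n + 1)).norm.measurable).stronglyMeasurable

lemma memLp_runMax {p : ℝ≥0∞} {M : ℕ → Ω → E} (hM : ∀ i, MemLp (M i) p P)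
    (n : ℕ) : MemLp (fun ω => runMax (fun i => M i ω) n) p P := by
  induction n with
  | zero => exact (hM 0).norm
  | succ n ih => exact ih.sup (hM (n + 1)).norm

variable [InnerProductSpace ℝ E]

lemma integral_inner_sub_eq_zero [CompleteSpace E] [IsFiniteMeasure P] {𝓖 : Filtration ℕ mΩ}
    {M : ℕ → Ω → E} (hM : Martingale M 𝓖 P) {i : ℕ} {G : Ω → E}
    (hG : StronglyMeasurable[𝓖 i] G)
    (hint : Integrable (fun ω => (inner ℝ (G ω) (M (i + 1) ω - M i ω) : ℝ)) P) :
    ∫ ω, (inner ℝ (G ω) (M (i + 1) ω - M i ω) : ℝ) ∂P = 0 := by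
  have hD : Integrable (M (i + 1) - M i) P := (hM.integrable _).sub (hM.integrable _)
  have h1 := condExp_bilin_of_stronglyMeasurable_left (μ := P) (innerSL ℝ) hG
    (g := M (i + 1) - M i) hint hD
  have h2 : P[M (i + 1) - M i | 𝓖 i] =ᵐ[P] 0 := by
    have h3 := condExp_sub (hM.integrable (i + 1)) (hM.integrable i) (𝓖 i)
    have h4 := hM.condExp_ae_eq i.le_succ
    have h5 := hM.condExp_ae_eq (le_refl i)
    filter_upwards [h3, h4, h5] with ω h3 h4 h5
    rw [h3, Pi.sub_apply, h4, h5, sub_self, Pi.zero_apply]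
  have h3 : P[fun ω => (innerSL ℝ (G ω)) ((M (i + 1) - M i) ω) | 𝓖 i] =ᵐ[P] 0 := by
    filter_upwards [h1, h2] with ω h1 h2
    rw [h1, h2]
    simp
  have h4 := integral_condExp (μ := P) (𝓖.le i)
    (f := fun ω => (innerSL ℝ (G ω)) ((M (i + 1) - M i) ω))
  rw [integral_congr_ae h3] at h4
  simpa using h4.symm

lemma stronglyMeasurable_pathGrad {𝓖 : Filtration ℕ mΩ} {M : ℕ → Ω → E}
    (hM : ∀ i, StronglyMeasurable[𝓖 i] (M i)) (p α β : ℝ) (i : ℕ) :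
    StronglyMeasurable[𝓖 i] (fun ω => pathGrad p α β (fun j => M j ω) i) := by
  have h1 := (hM i).norm.measurable
  have h2 := (stronglyMeasurable_runMax hM i).measurable
  exact ((((h1.pow_const (p - 2)).const_mul α).stronglyMeasurable).smul (hM i)).sub
    (((((h2.pow_const (p - 1)).const_mul β).mul h1.inv).stronglyMeasurable).smul (hM i))

/-- The integrand grows like the running maximum to the power p - 1, so Young's inequality dominates
the product by p-th powers of the maximum and of the increment. -/
lemma integrable_inner_pathGrad {p α β : ℝ} (hp : 2 ≤ p) (hα : 0 ≤ α) (hβ : 0 ≤ β)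
    {𝓖 : Filtration ℕ mΩ} {M : ℕ → Ω → E} (hM : ∀ i, StronglyMeasurable[𝓖 i] (M i))
    (hL : ∀ i, MemLp (M i) (ENNReal.ofReal p) P) (i : ℕ) :
    Integrable (fun ω => (inner ℝ (pathGrad p α β (fun j => M j ω) i)
      (M (i + 1) ω - M i ω) : ℝ)) P := by
  have hp0 : 0 ≤ p := by linarith
  have hpr : (ENNReal.ofReal p).toReal = p := ENNReal.toReal_ofReal hp0
  have hpz : ENNReal.ofReal p ≠ 0 := by simp; linarith
  obtain ⟨C, hC, hY⟩ := exists_mul_rpow_mul_rpow_le (p := p) (q := 1) (c := α + β) (η := 1)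
    le_rfl (by linarith) (by positivity) one_pos
  have h1 := (memLp_runMax hL i).integrable_norm_rpow hpz ENNReal.ofReal_ne_top
  have h2 := ((hL (i + 1)).sub (hL i)).integrable_norm_rpow hpz ENNReal.ofReal_ne_top
  rw [hpr] at h1 h2
  refine Integrable.mono' (h1.add (h2.const_mul C)) ?_ (Filter.Eventually.of_forall fun ω => ?_)
  · exact (((stronglyMeasurable_pathGrad hM p α β i).mono (𝓖.le i)).aestronglyMeasurable).inner
      ((hL (i + 1)).sub (hL i)).aestronglyMeasurable
  · have h3 := hY (runMax (fun j => M j ω) i) ‖M (i + 1) ω - M i ω‖ (runMax_nonneg _ _)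
      (norm_nonneg _)
    rw [Real.rpow_one, one_mul] at h3
    have h4 := norm_pathGrad_le hp hα hβ (fun j => M j ω) i
    simp only [Pi.add_apply, Pi.sub_apply, Real.norm_of_nonneg (runMax_nonneg (fun j => M j ω) i)]
    refine (norm_inner_le_norm _ _).trans (le_trans ?_ h3)
    rw [← mul_assoc]
    gcongr

/-- The Burkholder inequality in `L_m`, `m ≥ 2`, for discrete time martingales. -/
theorem exists_isBDGConst (m : ℝ) (hm : 2 ≤ m) (d : ℕ) : ∃ κ, IsBDGConst.{u} m d κ := by
  obtain ⟨C, α, β, hC, hα, hβ, hpath⟩ := exists_pathwise_burkholder hm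
  have hm0 : 0 < m := by linarith
  have hmr : (ENNReal.ofReal m).toReal = m := ENNReal.toReal_ofReal hm0.le
  have hmz : ENNReal.ofReal m ≠ 0 := by simpa using hm0
  have hmt : ENNReal.ofReal m ≠ ∞ := ENNReal.ofReal_ne_top
  refine ⟨C ^ m⁻¹, by positivity, fun Ω mΩ P _ 𝓖 M hM hM0 hL n => ?_⟩
  have hMs : ∀ i, StronglyMeasurable[𝓖 i] (M i) := hM.stronglyMeasurable
  have hS : MemLp (fun ω => Real.sqrt (∑ i ∈ Finset.range n, ‖M (i + 1) ω - M i ω‖ ^ 2))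
      (ENNReal.ofReal m) P := by
    have hsum : MemLp (fun ω => ∑ i ∈ Finset.range n, ‖M (i + 1) ω - M i ω‖)
        (ENNReal.ofReal m) P :=
      memLp_finsetSum _ fun i _ => ((hL (i + 1)).sub (hL i)).norm
    refine hsum.mono' ?_ (Filter.Eventually.of_forall fun ω => ?_)
    · refine Continuous.comp_aestronglyMeasurable Real.continuous_sqrt ?_
      exact Finset.aestronglyMeasurable_fun_sum _ fun i _ =>
        ((hL (i + 1)).sub (hL i)).aestronglyMeasurable.norm.pow 2
    · rw [Real.norm_of_nonneg (Real.sqrt_nonneg _)]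
      refine Real.sqrt_le_iff.2 ⟨Finset.sum_nonneg fun _ _ => norm_nonneg _, ?_⟩
      exact Finset.sum_sq_le_sq_sum_of_nonneg fun _ _ => norm_nonneg _
  have hSi := hS.integrable_norm_rpow hmz hmt
  have hMi := (hL n).integrable_norm_rpow hmz hmt
  rw [(hL n).eLpNorm_eq_integral_rpow_norm hmz hmt, hS.eLpNorm_eq_integral_rpow_norm hmz hmt,
    ← ENNReal.ofReal_mul (by positivity)]
  rw [hmr] at *
  rw [← Real.mul_rpow hC (integral_nonneg fun _ => by positivity)]
  refine ENNReal.ofReal_le_ofReal (Real.rpow_le_rpow (integral_nonneg fun _ => by positivity) ?_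
    (by positivity))
  have hgi : ∀ i, Integrable (fun ω => (inner ℝ (pathGrad m α β (fun j => M j ω) i)
      (M (i + 1) ω - M i ω) : ℝ)) P := integrable_inner_pathGrad hm hα hβ hMs hL
  have h0 : ∫ ω, ∑ i ∈ Finset.range n, (inner ℝ (pathGrad m α β (fun j => M j ω) i)
      (M (i + 1) ω - M i ω) : ℝ) ∂P = 0 := by
    rw [integral_finsetSum _ fun i _ => hgi i]
    exact Finset.sum_eq_zero fun i _ =>
      integral_inner_sub_eq_zero hM (stronglyMeasurable_pathGrad hMs m α β i) (hgi i)
  calc ∫ ω, ‖M n ω‖ ^ m ∂P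
      ≤ ∫ ω, (C * ‖Real.sqrt (∑ i ∈ Finset.range n, ‖M (i + 1) ω - M i ω‖ ^ 2)‖ ^ m +
        ∑ i ∈ Finset.range n, (inner ℝ (pathGrad m α β (fun j => M j ω) i)
          (M (i + 1) ω - M i ω) : ℝ)) ∂P := by
        refine integral_mono hMi ((hSi.const_mul C).add (integrable_finsetSum _ fun i _ => hgi i))
          fun ω => ?_
        refine le_trans ?_ ((hpath _ (fun j => M j ω) (congrFun hM0 ω) n).trans (le_of_eq ?_))
        · exact Real.rpow_le_rpow (norm_nonneg _) (norm_le_runMax (fun j => M j ω) n) hm0.le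
        · rw [Real.norm_of_nonneg (Real.sqrt_nonneg _)]
    _ = C * ∫ ω, ‖Real.sqrt (∑ i ∈ Finset.range n, ‖M (i + 1) ω - M i ω‖ ^ 2)‖ ^ m ∂P := by
        rw [integral_add (hSi.const_mul C) (integrable_finsetSum _ fun i _ => hgi i), h0,
          add_zero, integral_const_mul]

/-- The infimum defining `bdgConst` is attained. -/
theorem isBDGConst_bdgConst (m : ℝ) (hm : 2 ≤ m) (d : ℕ) :
    IsBDGConst.{u} m d (bdgConst.{u} m d) := by
  have hne : {κ : ℝ | IsBDGConst.{u} m d κ}.Nonempty := exists_isBDGConst m hm d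
  have hbd : BddBelow {κ : ℝ | IsBDGConst.{u} m d κ} := ⟨0, fun κ hκ => hκ.1⟩
  obtain ⟨v, -, hv, hvmem⟩ := exists_seq_tendsto_sInf hne hbd
  refine ⟨le_csInf hne fun κ hκ => hκ.1, fun Ω mΩ P hP 𝓖 M hM hM0 hL n => ?_⟩
  -- Finiteness allows the limit of constants to pass through the product in `ℝ≥0∞`, where a factor
  -- ∞ would obstruct continuity at 0.
  have hfin : eLpNorm (fun ω => Real.sqrt (∑ i ∈ Finset.range n, ‖M (i + 1) ω - M i ω‖ ^ 2))
      (ENNReal.ofReal m) P ≠ ∞ := by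
    have hsum : MemLp (fun ω => ∑ i ∈ Finset.range n, ‖M (i + 1) ω - M i ω‖)
        (ENNReal.ofReal m) P :=
      memLp_finsetSum _ fun i _ => ((hL (i + 1)).sub (hL i)).norm
    refine ((eLpNorm_mono_real fun ω => ?_).trans_lt hsum.eLpNorm_lt_top).ne
    rw [Real.norm_of_nonneg (Real.sqrt_nonneg _)]
    refine Real.sqrt_le_iff.2 ⟨Finset.sum_nonneg fun _ _ => norm_nonneg _, ?_⟩
    exact Finset.sum_sq_le_sq_sum_of_nonneg fun _ _ => norm_nonneg _
  have hlim : Filter.Tendsto (fun k => ENNReal.ofReal (v k) *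
      eLpNorm (fun ω => Real.sqrt (∑ i ∈ Finset.range n, ‖M (i + 1) ω - M i ω‖ ^ 2))
        (ENNReal.ofReal m) P) Filter.atTop
      (nhds (ENNReal.ofReal (bdgConst.{u} m d) *
        eLpNorm (fun ω => Real.sqrt (∑ i ∈ Finset.range n, ‖M (i + 1) ω - M i ω‖ ^ 2))
          (ENNReal.ofReal m) P)) :=
    ENNReal.Tendsto.mul_const (ENNReal.tendsto_ofReal hv) (Or.inr hfin)
  exact ge_of_tendsto' hlim fun k => (hvmem k).2 Ω mΩ P hP 𝓖 M hM hM0 hL n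

end Burkholder

/-! ### Moment bounds for sums of almost-martingale increments -/

section DiscreteSewing

lemma eLpNorm_norm_sq {Ω E : Type*} {mΩ : MeasurableSpace Ω} {P : Measure Ω}
    [NormedAddCommGroup E] {m : ℝ} (hm : 0 ≤ m) (f : Ω → E) :
    eLpNorm (fun ω => ‖f ω‖ ^ 2) (ENNReal.ofReal (m / 2)) P =
      eLpNorm f (ENNReal.ofReal m) P ^ 2 := by
  have h := eLpNorm_norm_rpow (p := ENNReal.ofReal (m / 2)) (μ := P) f (q := 2) two_pos
  rw [← ENNReal.ofReal_mul (by linarith), div_mul_cancel₀ _ two_ne_zero] at h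
  simpa using h

/-- Minkowski's inequality in L_{m/2} applied to the squares, which is where m ≥ 2 enters. -/
lemma eLpNorm_sqrt_sum_sq_le {Ω E : Type*} {mΩ : MeasurableSpace Ω} {P : Measure Ω}
    [NormedAddCommGroup E] {m : ℝ} (hm : 2 ≤ m) {D : ℕ → Ω → E} {a : ℕ → ℝ}
    (hD : ∀ i, AEStronglyMeasurable (D i) P) (ha : ∀ i, 0 ≤ a i)
    (hDa : ∀ i, eLpNorm (D i) (ENNReal.ofReal m) P ≤ ENNReal.ofReal (a i)) (n : ℕ) :
    eLpNorm (fun ω => Real.sqrt (∑ i ∈ Finset.range n, ‖D i ω‖ ^ 2)) (ENNReal.ofReal m) P ≤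
      ENNReal.ofReal (Real.sqrt (∑ i ∈ Finset.range n, a i ^ 2)) := by
  have hfun : (fun ω => ‖Real.sqrt (∑ i ∈ Finset.range n, ‖D i ω‖ ^ 2)‖ ^ 2) =
      ∑ i ∈ Finset.range n, fun ω => ‖D i ω‖ ^ 2 := by
    ext ω
    rw [Real.norm_of_nonneg (Real.sqrt_nonneg _),
      Real.sq_sqrt (Finset.sum_nonneg fun _ _ => by positivity), Finset.sum_apply]
  have hmain : eLpNorm (fun ω => Real.sqrt (∑ i ∈ Finset.range n, ‖D i ω‖ ^ 2))
      (ENNReal.ofReal m) P ^ 2 ≤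
      ENNReal.ofReal (Real.sqrt (∑ i ∈ Finset.range n, a i ^ 2)) ^ 2 := by
    rw [← eLpNorm_norm_sq (by linarith), hfun, ← ENNReal.ofReal_pow (Real.sqrt_nonneg _),
      Real.sq_sqrt (Finset.sum_nonneg fun _ _ => by positivity),
      ENNReal.ofReal_sum_of_nonneg fun _ _ => by positivity]
    have hsum := eLpNorm_sum_le (p := ENNReal.ofReal (m / 2)) (μ := P) (s := Finset.range n)
      (f := fun i ω => ‖D i ω‖ ^ 2) (fun i _ => (hD i).norm.pow 2) ?_
    · refine hsum.trans (Finset.sum_le_sum fun i _ => ?_)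
      rw [eLpNorm_norm_sq (by linarith), ENNReal.ofReal_pow (ha i)]
      exact pow_le_pow_left₀ zero_le (hDa i) 2
    · rw [← ENNReal.ofReal_one]
      exact ENNReal.ofReal_le_ofReal (by linarith)
  exact (ENNReal.pow_le_pow_left_iff two_ne_zero).1 hmain

variable {Ω : Type u} {mΩ : MeasurableSpace Ω} {P : Measure Ω} [IsProbabilityMeasure P] {d : ℕ}
  {m κ : ℝ}

lemma one_le_ofReal_of_two_le (hm : 2 ≤ m) : 1 ≤ ENNReal.ofReal m := by
  rw [← ENNReal.ofReal_one]
  exact ENNReal.ofReal_le_ofReal (by linarith)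

/-- Doob decomposition: the conditional expectations are summed by the triangle inequality, and the
centred terms form a martingale. Centring at most doubles the L_m norm, hence the factor 2. -/
lemma eLpNorm_sum_le_of_isBDGConst (hm : 2 ≤ m) (hκ : IsBDGConst.{u} m d κ)
    {𝓖 : Filtration ℕ mΩ} {Z : ℕ → Ω → EuclideanSpace ℝ (Fin d)} {a b : ℕ → ℝ}
    (hZ : ∀ i, StronglyMeasurable[𝓖 (i + 1)] (Z i))
    (hL : ∀ i, MemLp (Z i) (ENNReal.ofReal m) P) (ha : ∀ i, 0 ≤ a i) (hb : ∀ i, 0 ≤ b i)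
    (hZa : ∀ i, eLpNorm (Z i) (ENNReal.ofReal m) P ≤ ENNReal.ofReal (a i))
    (hZb : ∀ i, eLpNorm (P[Z i | 𝓖 i]) (ENNReal.ofReal m) P ≤ ENNReal.ofReal (b i)) (n : ℕ) :
    eLpNorm (∑ i ∈ Finset.range n, Z i) (ENNReal.ofReal m) P ≤
      ENNReal.ofReal (∑ i ∈ Finset.range n, b i +
        2 * κ * Real.sqrt (∑ i ∈ Finset.range n, a i ^ 2)) := by
  have hm1 := one_le_ofReal_of_two_le hm
  have hcL : ∀ i, MemLp (P[Z i | 𝓖 i]) (ENNReal.ofReal m) P := fun i => (hL i).condExp hm1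
  set D : ℕ → Ω → EuclideanSpace ℝ (Fin d) := fun i => Z i - P[Z i | 𝓖 i] with hD
  have hDL : ∀ i, MemLp (D i) (ENNReal.ofReal m) P := fun i => (hL i).sub (hcL i)
  have hDm : ∀ i, StronglyMeasurable[𝓖 (i + 1)] (D i) := fun i =>
    (hZ i).sub (stronglyMeasurable_condExp.mono (𝓖.mono i.le_succ))
  have hDa : ∀ i, eLpNorm (D i) (ENNReal.ofReal m) P ≤ ENNReal.ofReal (2 * a i) := fun i => by
    refine (eLpNorm_sub_le (hL i).aestronglyMeasurable (hcL i).aestronglyMeasurable hm1).trans ?_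
    rw [two_mul, ENNReal.ofReal_add (ha i) (ha i)]
    exact add_le_add (hZa i) ((eLpNorm_condExp_le_eLpNorm _ hm1).trans (hZa i))
  set M : ℕ → Ω → EuclideanSpace ℝ (Fin d) := fun k => ∑ i ∈ Finset.range k, D i with hM
  have hMsub : ∀ i, M (i + 1) - M i = D i := fun i => by
    simp [hM, Finset.sum_range_succ]
  have hML : ∀ k, MemLp (M k) (ENNReal.ofReal m) P := fun k =>
    memLp_finsetSum' _ fun i _ => hDL i
  have hmart : Martingale M 𝓖 P := by
    refine martingale_of_condExp_sub_eq_zero_nat (fun k => ?_) (fun k => (hML k).integrable hm1)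
      fun i => ?_
    · exact Finset.stronglyMeasurable_sum _ fun i hi =>
        (hDm i).mono (𝓖.mono (Finset.mem_range.1 hi))
    · rw [hMsub]
      have h1 := condExp_sub ((hL i).integrable hm1) ((hcL i).integrable hm1) (𝓖 i)
      have h2 : P[P[Z i | 𝓖 i] | 𝓖 i] = P[Z i | 𝓖 i] :=
        condExp_of_stronglyMeasurable (𝓖.le i) stronglyMeasurable_condExp
          ((hcL i).integrable hm1)
      filter_upwards [h1] with ω h1
      rw [h1, h2]
      simp
  have hbdg := hκ.2 Ω mΩ P inferInstance 𝓖 M hmart (by simp [hM]) hML n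
  have hsq : (fun ω => Real.sqrt (∑ i ∈ Finset.range n, ‖M (i + 1) ω - M i ω‖ ^ 2)) =
      fun ω => Real.sqrt (∑ i ∈ Finset.range n, ‖D i ω‖ ^ 2) := by
    simp_rw [← hMsub, Pi.sub_apply]
  rw [hsq] at hbdg
  have hmink := eLpNorm_sqrt_sum_sq_le hm (fun i => (hDL i).aestronglyMeasurable)
    (fun i => mul_nonneg zero_le_two (ha i)) hDa n
  have hs : Real.sqrt (∑ i ∈ Finset.range n, (2 * a i) ^ 2) =
      2 * Real.sqrt (∑ i ∈ Finset.range n, a i ^ 2) := by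
    simp_rw [mul_pow, ← Finset.mul_sum]
    rw [Real.sqrt_mul (by positivity), Real.sqrt_sq zero_le_two]
  have hκ0 := hκ.1
  have hdec : ∑ i ∈ Finset.range n, Z i = ∑ i ∈ Finset.range n, P[Z i | 𝓖 i] + M n := by
    simp [hM, hD, Finset.sum_sub_distrib]
  rw [hdec, ENNReal.ofReal_add (Finset.sum_nonneg fun i _ => hb i) (by positivity)]
  refine (eLpNorm_add_le (memLp_finsetSum' _ fun i _ => hcL i).aestronglyMeasurable
    (hML n).aestronglyMeasurable hm1).trans (add_le_add ?_ ?_)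
  · rw [ENNReal.ofReal_sum_of_nonneg fun i _ => hb i]
    exact (eLpNorm_sum_le (fun i _ => (hcL i).aestronglyMeasurable) hm1).trans
      (Finset.sum_le_sum fun i _ => hZb i)
  · refine hbdg.trans ((mul_le_mul_right hmink _).trans ?_)
    rw [hs, ← ENNReal.ofReal_mul hκ0]
    exact ENNReal.ofReal_le_ofReal (le_of_eq (by ring))

/-- By the tower property, conditioning on the initial σ-algebra factors through each `𝓖 i` and
contracts L_m; no martingale term remains. -/
lemma eLpNorm_condExp_sum_le (hm : 2 ≤ m) {𝓖 : Filtration ℕ mΩ}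
    {Z : ℕ → Ω → EuclideanSpace ℝ (Fin d)} {b : ℕ → ℝ}
    (hL : ∀ i, MemLp (Z i) (ENNReal.ofReal m) P) (hb : ∀ i, 0 ≤ b i)
    (hZb : ∀ i, eLpNorm (P[Z i | 𝓖 i]) (ENNReal.ofReal m) P ≤ ENNReal.ofReal (b i)) (n : ℕ) :
    eLpNorm (P[∑ i ∈ Finset.range n, Z i | 𝓖 0]) (ENNReal.ofReal m) P ≤
      ENNReal.ofReal (∑ i ∈ Finset.range n, b i) := by
  have hm1 := one_le_ofReal_of_two_le hm
  rw [eLpNorm_congr_ae (condExp_finsetSum (fun i _ => (hL i).integrable hm1) (𝓖 0)),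
    ENNReal.ofReal_sum_of_nonneg fun i _ => hb i]
  refine (eLpNorm_sum_le (fun i _ => ((hL i).condExp hm1).aestronglyMeasurable) hm1).trans
    (Finset.sum_le_sum fun i _ => ?_)
  rw [← eLpNorm_congr_ae (condExp_condExp_of_le (𝓖.mono i.zero_le) (𝓖.le i))]
  exact (eLpNorm_condExp_le_eLpNorm _ hm1).trans (hZb i)

/-- The discrete time filtration obtained by sampling a filtration along a monotone sequence. -/
def sampledFiltration (𝓕 : Filtration ℝ≥0 mΩ) (p : ℕ → ℝ≥0) (hp : Monotone p) :
    Filtration ℕ mΩ where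
  seq i := 𝓕 (p i)
  mono' _ _ hij := 𝓕.mono (hp hij)
  le' i := 𝓕.le (p i)

/-- The surplus exponent is spent on the mesh, leaving the length h itself, which telescopes over a
partition. -/
lemma rpow_one_add_le {h μ e : ℝ} (hh : 0 ≤ h) (hhμ : h ≤ μ) (he : 0 ≤ e) :
    h ^ (1 + e) ≤ μ ^ e * h := by
  rw [Real.rpow_add_of_nonneg hh zero_le_one he, Real.rpow_one, mul_comm]
  gcongr

lemma sum_mul_rpow_one_add_le {p : ℕ → ℝ≥0} (hp : Monotone p) {μ G e : ℝ} (hG : 0 ≤ G)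
    (he : 0 ≤ e) (hμ : ∀ i, (p (i + 1) : ℝ) - p i ≤ μ) (n : ℕ) :
    ∑ i ∈ Finset.range n, G * ((p (i + 1) : ℝ) - p i) ^ (1 + e) ≤
      G * μ ^ e * ((p n : ℝ) - p 0) := by
  rw [← Finset.sum_range_sub (fun i => (p i : ℝ)) n, Finset.mul_sum]
  refine Finset.sum_le_sum fun i _ => ?_
  have h0 : 0 ≤ (p (i + 1) : ℝ) - p i := sub_nonneg.2 (NNReal.coe_le_coe.2 (hp i.le_succ))
  rw [mul_assoc]
  exact mul_le_mul_of_nonneg_left (rpow_one_add_le h0 (hμ i) he) hG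

lemma sqrt_sum_sq_le {p : ℕ → ℝ≥0} (hp : Monotone p) {μ G e : ℝ} (hG : 0 ≤ G)
    (he : 0 ≤ e) (hμ : ∀ i, (p (i + 1) : ℝ) - p i ≤ μ) (n : ℕ) :
    Real.sqrt (∑ i ∈ Finset.range n, (G * ((p (i + 1) : ℝ) - p i) ^ (1 / 2 + e)) ^ 2) ≤
      G * μ ^ e * Real.sqrt ((p n : ℝ) - p 0) := by
  have hh : ∀ i, 0 ≤ (p (i + 1) : ℝ) - p i := fun i =>
    sub_nonneg.2 (NNReal.coe_le_coe.2 (hp i.le_succ))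
  have hμ0 : 0 ≤ μ := (hh 0).trans (hμ 0)
  have hsq : ∀ x : ℝ, 0 ≤ x → (x ^ (1 / 2 + e)) ^ 2 = x ^ (1 + 2 * e) := fun x hx => by
    rw [← Real.rpow_mul_natCast hx]
    congr 1
    push_cast
    ring
  have h1 : ∑ i ∈ Finset.range n, (G * ((p (i + 1) : ℝ) - p i) ^ (1 / 2 + e)) ^ 2 ≤
      (G * μ ^ e) ^ 2 * ((p n : ℝ) - p 0) := by
    have h2 := sum_mul_rpow_one_add_le hp (sq_nonneg G) (mul_nonneg zero_le_two he) hμ n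
    refine le_trans (Finset.sum_le_sum fun i _ => ?_) (h2.trans (le_of_eq ?_))
    · rw [mul_pow, hsq _ (hh i)]
    · rw [mul_pow, ← Real.rpow_mul_natCast hμ0, Nat.cast_ofNat, mul_comm e 2]
  calc _ ≤ Real.sqrt ((G * μ ^ e) ^ 2 * ((p n : ℝ) - p 0)) := Real.sqrt_le_sqrt h1
    _ = _ := by rw [Real.sqrt_mul (sq_nonneg _), Real.sqrt_sq (by positivity)]

/-- Moment bound for a sum of almost-martingale increments along a partition. -/
lemma eLpNorm_sum_partition_le (hm : 2 ≤ m) (hκ : IsBDGConst.{u} m d κ)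
    {𝓕 : Filtration ℝ≥0 mΩ} {p : ℕ → ℝ≥0} (hp : Monotone p)
    {Z : ℕ → Ω → EuclideanSpace ℝ (Fin d)} {G₁ G₄ e₁ e₄ μ : ℝ}
    (hG₁ : 0 ≤ G₁) (hG₄ : 0 ≤ G₄) (he₁ : 0 ≤ e₁) (he₄ : 0 ≤ e₄)
    (hμ : ∀ i, (p (i + 1) : ℝ) - p i ≤ μ)
    (hZ : ∀ i, StronglyMeasurable[𝓕 (p (i + 1))] (Z i))
    (hL : ∀ i, MemLp (Z i) (ENNReal.ofReal m) P)
    (hZa : ∀ i, eLpNorm (Z i) (ENNReal.ofReal m) P ≤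
      ENNReal.ofReal (G₄ * ((p (i + 1) : ℝ) - p i) ^ (1 / 2 + e₄)))
    (hZb : ∀ i, eLpNorm (P[Z i | 𝓕 (p i)]) (ENNReal.ofReal m) P ≤
      ENNReal.ofReal (G₁ * ((p (i + 1) : ℝ) - p i) ^ (1 + e₁))) (n : ℕ) :
    eLpNorm (∑ i ∈ Finset.range n, Z i) (ENNReal.ofReal m) P ≤
      ENNReal.ofReal (G₁ * μ ^ e₁ * ((p n : ℝ) - p 0) +
        2 * κ * (G₄ * μ ^ e₄ * Real.sqrt ((p n : ℝ) - p 0))) := by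
  have hh : ∀ i, 0 ≤ (p (i + 1) : ℝ) - p i := fun i =>
    sub_nonneg.2 (NNReal.coe_le_coe.2 (hp i.le_succ))
  refine (eLpNorm_sum_le_of_isBDGConst hm hκ (𝓖 := sampledFiltration 𝓕 p hp) hZ hL
    (fun i => mul_nonneg hG₄ (Real.rpow_nonneg (hh i) _))
    (fun i => mul_nonneg hG₁ (Real.rpow_nonneg (hh i) _)) hZa hZb n).trans
    (ENNReal.ofReal_le_ofReal ?_)
  have hκ0 := hκ.1
  exact add_le_add (sum_mul_rpow_one_add_le hp hG₁ he₁ hμ n)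
    (mul_le_mul_of_nonneg_left (sqrt_sum_sq_le hp hG₄ he₄ hμ n) (by positivity))

lemma eLpNorm_condExp_sum_partition_le (hm : 2 ≤ m)
    {𝓕 : Filtration ℝ≥0 mΩ} {p : ℕ → ℝ≥0} (hp : Monotone p)
    {Z : ℕ → Ω → EuclideanSpace ℝ (Fin d)} {G₁ e₁ μ : ℝ}
    (hG₁ : 0 ≤ G₁) (he₁ : 0 ≤ e₁) (hμ : ∀ i, (p (i + 1) : ℝ) - p i ≤ μ)
    (hL : ∀ i, MemLp (Z i) (ENNReal.ofReal m) P)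
    (hZb : ∀ i, eLpNorm (P[Z i | 𝓕 (p i)]) (ENNReal.ofReal m) P ≤
      ENNReal.ofReal (G₁ * ((p (i + 1) : ℝ) - p i) ^ (1 + e₁))) (n : ℕ) :
    eLpNorm (P[∑ i ∈ Finset.range n, Z i | 𝓕 (p 0)]) (ENNReal.ofReal m) P ≤
      ENNReal.ofReal (G₁ * μ ^ e₁ * ((p n : ℝ) - p 0)) := by
  have hh : ∀ i, 0 ≤ (p (i + 1) : ℝ) - p i := fun i =>
    sub_nonneg.2 (NNReal.coe_le_coe.2 (hp i.le_succ))
  exact (eLpNorm_condExp_sum_le hm (𝓖 := sampledFiltration 𝓕 p hp) hL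
    (fun i => mul_nonneg hG₁ (Real.rpow_nonneg (hh i) _)) hZb n).trans
    (ENNReal.ofReal_le_ofReal (sum_mul_rpow_one_add_le hp hG₁ he₁ hμ n))

end DiscreteSewing

/-! ### Limits in L^p and conditional expectations -/

section Limits

variable {Ω : Type*} {mΩ : MeasurableSpace Ω} {P : Measure Ω} {E : Type*}
  [NormedAddCommGroup E] {p : ℝ≥0∞}

/-- A sequence of functions measurable for a sub-σ-algebra with summable `L^p` increments
converges in `L^p` to a function measurable for the same σ-algebra. -/
lemma exists_tendsto_eLpNorm_of_summable [CompleteSpace E] (hp : 1 ≤ p) {𝓐 : MeasurableSpace Ω}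
    (h𝓐 : 𝓐 ≤ mΩ) {f : ℕ → Ω → E} (hf : ∀ n, StronglyMeasurable[𝓐] (f n))
    (hL : ∀ n, MemLp (f n) p P) {a : ℕ → ℝ} (ha : ∀ n, 0 ≤ a n) (hsum : Summable a)
    (hfa : ∀ n, eLpNorm (f n - f (n + 1)) p P ≤ ENNReal.ofReal (a n)) :
    ∃ J : Ω → E, StronglyMeasurable[𝓐] J ∧ MemLp J p P ∧
      Filter.Tendsto (fun n => eLpNorm (f n - J) p P) Filter.atTop (nhds 0) := by
  have : Fact (1 ≤ p) := ⟨hp⟩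
  -- Completeness is used in L^p of the trimmed measure, so that the limit is measurable for `𝓐`
  -- itself, not merely almost everywhere equal to such a function.
  have htL : ∀ n, MemLp (f n) p (P.trim h𝓐) := fun n =>
    ⟨(hf n).aestronglyMeasurable, by rw [eLpNorm_trim h𝓐 (hf n)]; exact (hL n).2⟩
  have hC : CauchySeq fun n => (htL n).toLp (f n) := by
    refine cauchySeq_of_edist_le_of_tsum_ne_top (fun n => ENNReal.ofReal (a n)) (fun n => ?_) ?_
    · rw [Lp.edist_toLp_toLp, eLpNorm_trim h𝓐 ((hf n).sub (hf (n + 1)))]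
      exact hfa n
    · rw [← ENNReal.ofReal_tsum_of_nonneg ha hsum]
      exact ENNReal.ofReal_ne_top
  obtain ⟨G, hG⟩ := cauchySeq_tendsto_of_complete hC
  refine ⟨G, Lp.stronglyMeasurable G, memLp_of_memLp_trim h𝓐 (Lp.memLp G), ?_⟩
  rw [← Lp.toLp_coeFn G (Lp.memLp G), Lp.tendsto_Lp_iff_tendsto_eLpNorm''] at hG
  refine hG.congr fun n => ?_
  exact eLpNorm_trim h𝓐 ((hf n).sub (Lp.stronglyMeasurable G))

lemma eLpNorm_le_of_tendsto (hp : 1 ≤ p) {f : ℕ → Ω → E} {J : Ω → E}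
    (hf : ∀ n, MemLp (f n) p P) (hJ : MemLp J p P)
    (h : Filter.Tendsto (fun n => eLpNorm (f n - J) p P) Filter.atTop (nhds 0)) {C : ℝ≥0∞}
    (hC : ∀ n, eLpNorm (f n) p P ≤ C) : eLpNorm J p P ≤ C := by
  have h2 : Filter.Tendsto (fun n => C + eLpNorm (f n - J) p P) Filter.atTop (nhds C) := by
    simpa using h.const_add C
  refine ge_of_tendsto' h2 fun n => ?_
  calc eLpNorm J p P = eLpNorm (f n - (f n - J)) p P := by rw [sub_sub_cancel]
    _ ≤ eLpNorm (f n) p P + eLpNorm (f n - J) p P :=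
      eLpNorm_sub_le (hf n).1 ((hf n).sub hJ).1 hp
    _ ≤ C + eLpNorm (f n - J) p P := by gcongr; exact hC n

lemma ae_eq_of_tendsto_eLpNorm (hp : 1 ≤ p) {f : ℕ → Ω → E} {J J' : Ω → E}
    (hf : ∀ n, MemLp (f n) p P) (hJ : MemLp J p P) (hJ' : MemLp J' p P)
    (h : Filter.Tendsto (fun n => eLpNorm (f n - J) p P) Filter.atTop (nhds 0))
    (h' : Filter.Tendsto (fun n => eLpNorm (f n - J') p P) Filter.atTop (nhds 0)) :
    J =ᵐ[P] J' := by
  have h0 : eLpNorm (J - J') p P = 0 := by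
    have h2 := h.add h'
    rw [add_zero] at h2
    refine le_antisymm (ge_of_tendsto' h2 fun n => ?_) zero_le
    calc eLpNorm (J - J') p P = eLpNorm ((f n - J') - (f n - J)) p P := by
          congr 1; abel
      _ ≤ eLpNorm (f n - J') p P + eLpNorm (f n - J) p P :=
        eLpNorm_sub_le ((hf n).sub hJ').1 ((hf n).sub hJ).1 hp
      _ = _ := add_comm _ _
  rw [eLpNorm_eq_zero_iff (hJ.sub hJ').1 (by positivity)] at h0
  filter_upwards [h0] with ω hω
  exact sub_eq_zero.1 hω

lemma eLpNorm_zero_sub_le_sum (hp : 1 ≤ p) {f : ℕ → Ω → E} (hf : ∀ n, MemLp (f n) p P)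
    {a : ℕ → ℝ} (ha : ∀ n, 0 ≤ a n) (hsum : Summable a)
    (hfa : ∀ n, eLpNorm (f n - f (n + 1)) p P ≤ ENNReal.ofReal (a n)) (n : ℕ) :
    eLpNorm (f n - f 0) p P ≤ ENNReal.ofReal (∑' i, a i) := by
  rw [← Finset.sum_range_sub f n]
  refine (eLpNorm_sum_le (fun i _ => ((hf (i + 1)).sub (hf i)).1) hp).trans ?_
  refine le_trans ?_ (ENNReal.ofReal_le_ofReal (hsum.sum_le_tsum (Finset.range n) fun i _ => ha i))
  rw [ENNReal.ofReal_sum_of_nonneg fun i _ => ha i]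
  refine Finset.sum_le_sum fun i _ => ?_
  rw [eLpNorm_sub_comm]
  exact hfa i

variable [IsFiniteMeasure P] [NormedSpace ℝ E] [CompleteSpace E]

lemma eLpNorm_condExp_le_of_tendsto (hp : 1 ≤ p) {𝓑 : MeasurableSpace Ω} {f : ℕ → Ω → E}
    {J : Ω → E} (hf : ∀ n, MemLp (f n) p P) (hJ : MemLp J p P)
    (h : Filter.Tendsto (fun n => eLpNorm (f n - J) p P) Filter.atTop (nhds 0)) {C : ℝ≥0∞}
    (hC : ∀ n, eLpNorm (P[f n | 𝓑]) p P ≤ C) : eLpNorm (P[J | 𝓑]) p P ≤ C := by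
  refine eLpNorm_le_of_tendsto hp (fun n => (hf n).condExp hp) (hJ.condExp hp) ?_ hC
  refine tendsto_of_tendsto_of_tendsto_of_le_of_le tendsto_const_nhds h (fun _ => zero_le)
    fun n => ?_
  rw [← eLpNorm_congr_ae (condExp_sub ((hf n).integrable hp) (hJ.integrable hp) 𝓑)]
  exact eLpNorm_condExp_le_eLpNorm _ hp

lemma eLpNorm_condExp_zero_sub_le_sum (hp : 1 ≤ p) {𝓑 : MeasurableSpace Ω} {f : ℕ → Ω → E}
    (hf : ∀ n, MemLp (f n) p P) {b : ℕ → ℝ} (hb : ∀ n, 0 ≤ b n) (hsum : Summable b)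
    (hfb : ∀ n, eLpNorm (P[f n - f (n + 1) | 𝓑]) p P ≤ ENNReal.ofReal (b n)) (n : ℕ) :
    eLpNorm (P[f n - f 0 | 𝓑]) p P ≤ ENNReal.ofReal (∑' i, b i) := by
  have hi : ∀ n, Integrable (f n) P := fun n => (hf n).integrable hp
  have hs : ∀ i j, P[f i - f j | 𝓑] =ᵐ[P] P[f i | 𝓑] - P[f j | 𝓑] := fun i j =>
    condExp_sub (hi i) (hi j) 𝓑
  rw [eLpNorm_congr_ae (hs n 0)]
  refine eLpNorm_zero_sub_le_sum (f := fun n => P[f n | 𝓑]) hp (fun n => (hf n).condExp hp) hb hsum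
    (fun n => ?_) n
  rw [← eLpNorm_congr_ae (hs n (n + 1))]
  exact hfb n

end Limits

/-! ### Clamped dyadic grids and grid sums -/

section Grid

/-- The dyadic grid of level `n` on `[a, a + L]`, clamped to `[s, t]`. -/
noncomputable def gridPoint (a L s t : ℝ≥0) (n i : ℕ) : ℝ≥0 :=
  max s (min t (a + i * L / 2 ^ n))

variable {a L s t : ℝ≥0}

lemma gridPoint_mono (a L s t : ℝ≥0) (n : ℕ) : Monotone (gridPoint a L s t n) := by
  intro i j hij
  unfold gridPoint
  gcongr

lemma le_gridPoint (a L s t : ℝ≥0) (n i : ℕ) : s ≤ gridPoint a L s t n i := le_max_left _ _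

lemma gridPoint_le (hst : s ≤ t) (n i : ℕ) : gridPoint a L s t n i ≤ t :=
  max_le hst (min_le_left _ _)

lemma gridPoint_zero (has : a ≤ s) (n : ℕ) : gridPoint a L s t n 0 = s := by
  simp [gridPoint, has]

lemma gridPoint_two_pow (hst : s ≤ t) (htL : t ≤ a + L) (n : ℕ) :
    gridPoint a L s t n (2 ^ n) = t := by
  have : a + ((2 ^ n : ℕ) : ℝ≥0) * L / 2 ^ n = a + L := by
    rw [Nat.cast_pow, Nat.cast_ofNat, mul_div_cancel_left₀ _ (by positivity)]
  rw [gridPoint, this, min_eq_left htL, max_eq_right hst]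

lemma gridPoint_succ_two_mul (a L s t : ℝ≥0) (n i : ℕ) :
    gridPoint a L s t (n + 1) (2 * i) = gridPoint a L s t n i := by
  have : ((2 * i : ℕ) : ℝ≥0) * L / 2 ^ (n + 1) = i * L / 2 ^ n := by
    rw [Nat.cast_mul, Nat.cast_ofNat, pow_succ', mul_assoc,
      mul_div_mul_left _ _ (two_ne_zero)]
  rw [gridPoint, this, gridPoint]

lemma gridPoint_le_midpoint (a L s t : ℝ≥0) (n i : ℕ) :
    gridPoint a L s t n i ≤ gridPoint a L s t (n + 1) (2 * i + 1) ∧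
      gridPoint a L s t (n + 1) (2 * i + 1) ≤ gridPoint a L s t n (i + 1) := by
  rw [← gridPoint_succ_two_mul a L s t n i, ← gridPoint_succ_two_mul a L s t n (i + 1)]
  exact ⟨gridPoint_mono _ _ _ _ _ (by omega), gridPoint_mono _ _ _ _ _ (by omega)⟩

lemma gridPoint_sub_le (a L s t : ℝ≥0) (n i : ℕ) :
    (gridPoint a L s t n (i + 1) : ℝ) - gridPoint a L s t n i ≤ L / 2 ^ n := by
  have h1 : a + ((i + 1 : ℕ) : ℝ≥0) * L / 2 ^ n = (a + i * L / 2 ^ n) + L / 2 ^ n := by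
    push_cast
    ring
  have h2 : gridPoint a L s t n (i + 1) ≤ gridPoint a L s t n i + L / 2 ^ n := by
    rw [gridPoint, gridPoint, h1]
    refine max_le ((le_max_left _ _).trans le_self_add) ?_
    rcases le_total t (a + i * L / 2 ^ n) with h | h
    · refine (min_le_left _ _).trans (le_trans ?_ le_self_add)
      rw [min_eq_left h]
      exact le_max_right _ _
    · refine (min_le_right _ _).trans ?_
      rw [min_eq_right h]
      gcongr
      exact le_max_right _ _
  have h3 := NNReal.coe_le_coe.2 h2
  push_cast at h3
  linarith

lemma gridPoint_sub_le_sub (hst : s ≤ t) (n i : ℕ) :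
    (gridPoint a L s t n (i + 1) : ℝ) - gridPoint a L s t n i ≤ t - s := by
  have h1 := NNReal.coe_le_coe.2 (gridPoint_le (a := a) (L := L) hst n (i + 1))
  have h2 := NNReal.coe_le_coe.2 (le_gridPoint a L s t n i)
  linarith

/-- Together with `gridPoint_max`: the grids clamped to [r, s] and [s, t] arise from that of [r, t]
by cutting at s, index by index. This permits a termwise comparison of the three grid sums. -/
lemma gridPoint_min {a L r s t : ℝ≥0} (hrs : r ≤ s) (hst : s ≤ t) (n i : ℕ) :
    min (gridPoint a L r t n i) s = gridPoint a L r s n i := by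
  rw [gridPoint, gridPoint, min_max_distrib_right, min_eq_left hrs, min_right_comm,
    min_eq_right hst]

lemma gridPoint_max {a L r s t : ℝ≥0} (hrs : r ≤ s) (n i : ℕ) :
    max (gridPoint a L r t n i) s = gridPoint a L s t n i := by
  rw [gridPoint, gridPoint, max_right_comm, max_eq_right hrs]

/-- The geometric mean of the two mesh bounds t - s and L / 2 ^ n: it decays geometrically in n yet
keeps a power of t - s. -/
lemma gridPoint_sub_le_sqrt {a L s t : ℝ≥0} (hst : s ≤ t) (n i : ℕ) :
    (gridPoint a L s t n (i + 1) : ℝ) - gridPoint a L s t n i ≤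
      Real.sqrt (((t : ℝ) - s) * L) * Real.sqrt (1 / 2) ^ n := by
  have hts : 0 ≤ (t : ℝ) - s := sub_nonneg.2 hst
  have h0 : 0 ≤ (gridPoint a L s t n (i + 1) : ℝ) - gridPoint a L s t n i :=
    sub_nonneg.2 (NNReal.coe_le_coe.2 (gridPoint_mono a L s t n i.le_succ))
  refine le_of_sq_le_sq ?_ (by positivity)
  rw [mul_pow, ← pow_mul, mul_comm n 2, pow_mul, Real.sq_sqrt (by positivity),
    Real.sq_sqrt (by norm_num), sq]
  calc _ ≤ ((t : ℝ) - s) * (L / 2 ^ n) :=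
        mul_le_mul (gridPoint_sub_le_sub hst n i) (gridPoint_sub_le a L s t n i) h0 hts
    _ = _ := by rw [one_div, inv_pow]; ring

lemma sum_range_two_mul {M : Type*} [AddCommMonoid M] (f : ℕ → M) (N : ℕ) :
    ∑ i ∈ Finset.range (2 * N), f i = ∑ i ∈ Finset.range N, (f (2 * i) + f (2 * i + 1)) := by
  induction N with
  | zero => simp
  | succ N ih => rw [Nat.mul_succ, Finset.sum_range_succ, Finset.sum_range_succ, ih,
      Finset.sum_range_succ, add_assoc]

/-- The sum of a two-parameter process along a clamped dyadic grid. -/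
noncomputable def gridSum {Ω : Type*} {d : ℕ} (A : ℝ≥0 → ℝ≥0 → Ω → EuclideanSpace ℝ (Fin d))
    (a L s t : ℝ≥0) (n : ℕ) : Ω → EuclideanSpace ℝ (Fin d) :=
  ∑ i ∈ Finset.range (2 ^ n), A (gridPoint a L s t n i) (gridPoint a L s t n (i + 1))

/-- The even points of the next level are the old grid, so each old cell is split by exactly one new
point. -/
lemma gridSum_sub_gridSum_succ {Ω : Type*} {d : ℕ}
    (A : ℝ≥0 → ℝ≥0 → Ω → EuclideanSpace ℝ (Fin d)) (a L s t : ℝ≥0) (n : ℕ) :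
    gridSum A a L s t n - gridSum A a L s t (n + 1) =
      ∑ i ∈ Finset.range (2 ^ n), incr A (gridPoint a L s t n i)
        (gridPoint a L s t (n + 1) (2 * i + 1)) (gridPoint a L s t n (i + 1)) := by
  rw [gridSum, gridSum, pow_succ', sum_range_two_mul, ← Finset.sum_sub_distrib]
  refine Finset.sum_congr rfl fun i _ => ?_
  rw [show 2 * i + 1 + 1 = 2 * (i + 1) by ring, gridPoint_succ_two_mul, gridPoint_succ_two_mul,
    incr]
  abel

end Grid

/-! ### Geometric series of mesh powers -/

section Geometric

lemma mul_pow_rpow {ν ρ : ℝ} (hν : 0 ≤ ν) (hρ : 0 ≤ ρ) (e : ℝ) (n : ℕ) :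
    (ν * ρ ^ n) ^ e = ν ^ e * (ρ ^ e) ^ n := by
  rw [Real.mul_rpow hν (by positivity), ← Real.rpow_natCast, ← Real.rpow_natCast,
    ← Real.rpow_mul hρ, ← Real.rpow_mul hρ, mul_comm e]

lemma hasSum_mul_pow_rpow {ν ρ e : ℝ} (hν : 0 ≤ ν) (hρ : 0 ≤ ρ) (hρ1 : ρ < 1) (he : 0 < e) :
    HasSum (fun n : ℕ => (ν * ρ ^ n) ^ e) (ν ^ e * (1 - ρ ^ e)⁻¹) := by
  simp_rw [mul_pow_rpow hν hρ]
  exact (hasSum_geometric_of_lt_one (by positivity) (Real.rpow_lt_one hρ hρ1 he)).mul_left _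

lemma tendsto_ofReal_mesh {e₁ e₄ : ℝ} (h₁ : 0 < e₁) (h₄ : 0 < e₄) (L : ℝ≥0) (G x y : ℝ) :
    Filter.Tendsto (fun n : ℕ => ENNReal.ofReal (G * ((L : ℝ) * (1 / 2) ^ n) ^ e₁ * x +
      y * ((L : ℝ) * (1 / 2) ^ n) ^ e₄)) Filter.atTop (nhds 0) := by
  have hhalf : (0 : ℝ) ≤ 1 / 2 := by norm_num
  have hz : ∀ e : ℝ, 0 < e → Filter.Tendsto (fun n : ℕ => ((L : ℝ) * (1 / 2) ^ n) ^ e)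
      Filter.atTop (nhds 0) := fun e he =>
    (hasSum_mul_pow_rpow L.2 hhalf (by norm_num) he).summable.tendsto_atTop_zero
  have h2 := (((hz e₁ h₁).const_mul G).mul_const x).add ((hz e₄ h₄).const_mul y)
  simp only [mul_zero, zero_mul, add_zero] at h2
  simpa using ENNReal.tendsto_ofReal h2

/-- On a bounded range the smaller exponent dominates. The cap 1/2 in e = min (1/2) e₄ keeps 1/2 + e
below 1 + e₁. -/
lemma exists_rpow_add_rpow_le {C₁ C₄ e₁ e₄ : ℝ} (hC₁ : 0 ≤ C₁) (hC₄ : 0 ≤ C₄) (he₁ : 0 < e₁)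
    (he₄ : 0 < e₄) {R : ℝ} (hR : 0 ≤ R) :
    ∃ C e : ℝ, 0 ≤ C ∧ 0 < e ∧ ∀ x : ℝ, 0 ≤ x → x ≤ R →
      C₁ * x ^ (1 + e₁) + C₄ * x ^ (1 / 2 + e₄) ≤ C * x ^ (1 / 2 + e) := by
  have he : 0 < min (1 / 2) e₄ := lt_min (by norm_num) he₄
  have hle : ∀ x b : ℝ, 0 ≤ x → x ≤ R → 1 / 2 + min (1 / 2) e₄ ≤ b →
      x ^ b ≤ R ^ (b - (1 / 2 + min (1 / 2) e₄)) * x ^ (1 / 2 + min (1 / 2) e₄) := by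
    intro x b hx hxR hb
    calc x ^ b = x ^ (b - (1 / 2 + min (1 / 2) e₄)) * x ^ (1 / 2 + min (1 / 2) e₄) := by
          rw [← Real.rpow_add_of_nonneg hx (by linarith) (by linarith), sub_add_cancel]
      _ ≤ _ := by
          have := Real.rpow_le_rpow hx hxR (sub_nonneg.2 hb)
          gcongr
  refine ⟨C₁ * R ^ (1 + e₁ - (1 / 2 + min (1 / 2) e₄)) +
    C₄ * R ^ (1 / 2 + e₄ - (1 / 2 + min (1 / 2) e₄)), min (1 / 2) e₄, by positivity, he,
    fun x hx hxR => ?_⟩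
  have h1 := mul_le_mul_of_nonneg_left (hle x (1 + e₁) hx hxR
    (by linarith [min_le_left (1 / 2) e₄])) hC₁
  have h4 := mul_le_mul_of_nonneg_left (hle x (1 / 2 + e₄) hx hxR
    (by linarith [min_le_right (1 / 2) e₄])) hC₄
  linarith

end Geometric

/-! ### Estimates for the germ and convergence of its grid sums -/

section Germ

variable {Ω : Type u} {mΩ : MeasurableSpace Ω} {d : ℕ}

/-- The hypotheses on a two-parameter process under which it can be sewn. -/
structure IsSewingGerm (P : Measure Ω) (𝓕 : Filtration ℝ≥0 mΩ) (S T : ℝ≥0)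
    (m Γ₁ Γ₄ ε₁ ε₄ : ℝ) (A : ℝ≥0 → ℝ≥0 → Ω → EuclideanSpace ℝ (Fin d)) : Prop where
  two_le : 2 ≤ m
  nonneg₁ : 0 ≤ Γ₁
  nonneg₄ : 0 ≤ Γ₄
  pos₁ : 0 < ε₁
  pos₄ : 0 < ε₄
  adapted : ∀ s t, S ≤ s → s ≤ t → t ≤ T → StronglyMeasurable[𝓕 t] (A s t)
  memLp : ∀ s t, S ≤ s → s ≤ t → t ≤ T → MemLp (A s t) (ENNReal.ofReal m) P
  cond : ∀ s r t : ℝ≥0, S ≤ s → s ≤ r → r ≤ t → t ≤ T →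
    eLpNorm (P[incr A s r t | 𝓕 s]) (ENNReal.ofReal m) P ≤
      ENNReal.ofReal (Γ₁ * ((t : ℝ) - s) ^ (1 + ε₁))
  size : ∀ s t : ℝ≥0, S ≤ s → s ≤ t → t ≤ T →
    eLpNorm (A s t) (ENNReal.ofReal m) P ≤
      ENNReal.ofReal (Γ₄ * ((t : ℝ) - s) ^ (1 / 2 + ε₄))

namespace IsSewingGerm

variable {P : Measure Ω} {𝓕 : Filtration ℝ≥0 mΩ} {S T : ℝ≥0} {m Γ₁ Γ₄ ε₁ ε₄ κ : ℝ}
  {A : ℝ≥0 → ℝ≥0 → Ω → EuclideanSpace ℝ (Fin d)}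

lemma one_le (h : IsSewingGerm P 𝓕 S T m Γ₁ Γ₄ ε₁ ε₄ A) : 1 ≤ ENNReal.ofReal m :=
  one_le_ofReal_of_two_le h.two_le

/-- Makes the degenerate cells created by clamping negligible. -/
lemma diag_ae_eq_zero (h : IsSewingGerm P 𝓕 S T m Γ₁ Γ₄ ε₁ ε₄ A) {s : ℝ≥0} (hs : S ≤ s)
    (hsT : s ≤ T) : A s s =ᵐ[P] 0 := by
  have h1 := h.size s s hs le_rfl hsT
  rw [sub_self, Real.zero_rpow (by linarith [h.pos₄]), mul_zero, ENNReal.ofReal_zero] at h1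
  have hne : ENNReal.ofReal m ≠ 0 := (zero_lt_one.trans_le h.one_le).ne'
  exact (eLpNorm_eq_zero_iff (h.memLp s s hs le_rfl hsT).1 hne).1 (le_antisymm h1 zero_le)

lemma stronglyMeasurable_incr (h : IsSewingGerm P 𝓕 S T m Γ₁ Γ₄ ε₁ ε₄ A) {s r t : ℝ≥0}
    (hs : S ≤ s) (hsr : s ≤ r) (hrt : r ≤ t) (ht : t ≤ T) :
    StronglyMeasurable[𝓕 t] (incr A s r t) :=
  ((h.adapted s t hs (hsr.trans hrt) ht).sub
    ((h.adapted s r hs hsr (hrt.trans ht)).mono (𝓕.mono hrt))).sub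
    (h.adapted r t (hs.trans hsr) hrt ht)

lemma memLp_incr (h : IsSewingGerm P 𝓕 S T m Γ₁ Γ₄ ε₁ ε₄ A) {s r t : ℝ≥0}
    (hs : S ≤ s) (hsr : s ≤ r) (hrt : r ≤ t) (ht : t ≤ T) :
    MemLp (incr A s r t) (ENNReal.ofReal m) P :=
  ((h.memLp s t hs (hsr.trans hrt) ht).sub (h.memLp s r hs hsr (hrt.trans ht))).sub
    (h.memLp r t (hs.trans hsr) hrt ht)

lemma eLpNorm_incr_le (h : IsSewingGerm P 𝓕 S T m Γ₁ Γ₄ ε₁ ε₄ A) {s r t : ℝ≥0}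
    (hs : S ≤ s) (hsr : s ≤ r) (hrt : r ≤ t) (ht : t ≤ T) :
    eLpNorm (incr A s r t) (ENNReal.ofReal m) P ≤
      ENNReal.ofReal (3 * Γ₄ * ((t : ℝ) - s) ^ (1 / 2 + ε₄)) := by
  have hsr' : (s : ℝ) ≤ r := hsr
  have hrt' : (r : ℝ) ≤ t := hrt
  have hΓ := h.nonneg₄
  have hε := h.pos₄
  have hts : 0 ≤ (t : ℝ) - s := by linarith
  have h1 := h.size s t hs (hsr.trans hrt) ht
  have h2 := (h.size s r hs hsr (hrt.trans ht)).trans (ENNReal.ofReal_le_ofReal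
    (mul_le_mul_of_nonneg_left (Real.rpow_le_rpow (sub_nonneg.2 hsr')
      (show (r : ℝ) - s ≤ t - s by linarith) (show 0 ≤ 1 / 2 + ε₄ by linarith)) hΓ))
  have h3 := (h.size r t (hs.trans hsr) hrt ht).trans (ENNReal.ofReal_le_ofReal
    (mul_le_mul_of_nonneg_left (Real.rpow_le_rpow (sub_nonneg.2 hrt')
      (show (t : ℝ) - r ≤ t - s by linarith) (show 0 ≤ 1 / 2 + ε₄ by linarith)) hΓ))
  have hm1 := h.one_le
  have m1 := h.memLp s t hs (hsr.trans hrt) ht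
  have m2 := h.memLp s r hs hsr (hrt.trans ht)
  have m3 := h.memLp r t (hs.trans hsr) hrt ht
  refine (eLpNorm_sub_le (m1.sub m2).1 m3.1 hm1).trans
    ((add_le_add ((eLpNorm_sub_le m1.1 m2.1 hm1).trans (add_le_add h1 h2)) h3).trans ?_)
  rw [← ENNReal.ofReal_add (by positivity) (by positivity),
    ← ENNReal.ofReal_add (by positivity) (by positivity)]
  exact ENNReal.ofReal_le_ofReal (le_of_eq (by ring))

lemma stronglyMeasurable_gridSum (h : IsSewingGerm P 𝓕 S T m Γ₁ Γ₄ ε₁ ε₄ A)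
    {a L s t : ℝ≥0} (hs : S ≤ s)
    (hst : s ≤ t) (ht : t ≤ T) (n : ℕ) : StronglyMeasurable[𝓕 t] (gridSum A a L s t n) :=
  Finset.stronglyMeasurable_sum _ fun i _ =>
    (h.adapted _ _ (hs.trans (le_gridPoint a L s t n i)) (gridPoint_mono a L s t n i.le_succ)
      ((gridPoint_le hst n (i + 1)).trans ht)).mono (𝓕.mono (gridPoint_le hst n (i + 1)))

lemma memLp_gridSum (h : IsSewingGerm P 𝓕 S T m Γ₁ Γ₄ ε₁ ε₄ A)
    {a L s t : ℝ≥0} (hs : S ≤ s)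
    (hst : s ≤ t) (ht : t ≤ T) (n : ℕ) :
    MemLp (gridSum A a L s t n) (ENNReal.ofReal m) P :=
  memLp_finsetSum' _ fun i _ =>
    h.memLp _ _ (hs.trans (le_gridPoint a L s t n i)) (gridPoint_mono a L s t n i.le_succ)
      ((gridPoint_le hst n (i + 1)).trans ht)

variable [IsProbabilityMeasure P]

/-- The inserted points q are arbitrary within their cells, so this serves both dyadic refinement
and the insertion of a single point. The 6 is 2 from centring times 3 from the three terms of
`incr`. -/
lemma eLpNorm_sum_incr_le (h : IsSewingGerm P 𝓕 S T m Γ₁ Γ₄ ε₁ ε₄ A)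
    (hκ : IsBDGConst.{u} m d κ) {p q : ℕ → ℝ≥0} (hp : Monotone p) (hpS : ∀ i, S ≤ p i)
    (hpT : ∀ i, p i ≤ T) (hpq : ∀ i, p i ≤ q i) (hqp : ∀ i, q i ≤ p (i + 1)) {μ : ℝ}
    (hμ : ∀ i, (p (i + 1) : ℝ) - p i ≤ μ) (n : ℕ) :
    eLpNorm (∑ i ∈ Finset.range n, incr A (p i) (q i) (p (i + 1))) (ENNReal.ofReal m) P ≤
      ENNReal.ofReal (Γ₁ * μ ^ ε₁ * ((p n : ℝ) - p 0) +
        6 * κ * Γ₄ * μ ^ ε₄ * Real.sqrt ((p n : ℝ) - p 0)) := by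
  refine (eLpNorm_sum_partition_le h.two_le hκ hp h.nonneg₁
    (mul_nonneg zero_le_three h.nonneg₄) h.pos₁.le h.pos₄.le hμ
    (fun i => h.stronglyMeasurable_incr (hpS i) (hpq i) (hqp i) (hpT _))
    (fun i => h.memLp_incr (hpS i) (hpq i) (hqp i) (hpT _))
    (fun i => h.eLpNorm_incr_le (hpS i) (hpq i) (hqp i) (hpT _))
    (fun i => h.cond _ _ _ (hpS i) (hpq i) (hqp i) (hpT _)) n).trans
    (ENNReal.ofReal_le_ofReal (le_of_eq (by ring)))

lemma eLpNorm_condExp_sum_incr_le (h : IsSewingGerm P 𝓕 S T m Γ₁ Γ₄ ε₁ ε₄ A)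
    {p q : ℕ → ℝ≥0} (hp : Monotone p) (hpS : ∀ i, S ≤ p i)
    (hpT : ∀ i, p i ≤ T) (hpq : ∀ i, p i ≤ q i) (hqp : ∀ i, q i ≤ p (i + 1)) {μ : ℝ}
    (hμ : ∀ i, (p (i + 1) : ℝ) - p i ≤ μ) (n : ℕ) :
    eLpNorm (P[∑ i ∈ Finset.range n, incr A (p i) (q i) (p (i + 1)) | 𝓕 (p 0)])
      (ENNReal.ofReal m) P ≤ ENNReal.ofReal (Γ₁ * μ ^ ε₁ * ((p n : ℝ) - p 0)) :=
  eLpNorm_condExp_sum_partition_le h.two_le hp h.nonneg₁ h.pos₁.le hμ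
    (fun i => h.memLp_incr (hpS i) (hpq i) (hqp i) (hpT _))
    (fun i => h.cond _ _ _ (hpS i) (hpq i) (hqp i) (hpT _)) n

section Grid

variable {a L s t : ℝ≥0}

lemma eLpNorm_gridSum_sub_succ_le (h : IsSewingGerm P 𝓕 S T m Γ₁ Γ₄ ε₁ ε₄ A)
    (hκ : IsBDGConst.{u} m d κ) (hs : S ≤ s) (hst : s ≤ t) (ht : t ≤ T) (has : a ≤ s)
    (htL : t ≤ a + L) {μ : ℝ} {n : ℕ}
    (hμ : ∀ i, (gridPoint a L s t n (i + 1) : ℝ) - gridPoint a L s t n i ≤ μ) :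
    eLpNorm (gridSum A a L s t n - gridSum A a L s t (n + 1)) (ENNReal.ofReal m) P ≤
      ENNReal.ofReal (Γ₁ * μ ^ ε₁ * ((t : ℝ) - s) +
        6 * κ * Γ₄ * μ ^ ε₄ * Real.sqrt ((t : ℝ) - s)) := by
  have h1 := h.eLpNorm_sum_incr_le hκ (gridPoint_mono a L s t n)
    (q := fun i => gridPoint a L s t (n + 1) (2 * i + 1))
    (fun i => hs.trans (le_gridPoint a L s t n i)) (fun i => (gridPoint_le hst n i).trans ht)
    (fun i => (gridPoint_le_midpoint a L s t n i).1)
    (fun i => (gridPoint_le_midpoint a L s t n i).2) hμ (2 ^ n)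
  rwa [gridPoint_zero has, gridPoint_two_pow hst htL, ← gridSum_sub_gridSum_succ] at h1

lemma eLpNorm_condExp_gridSum_sub_succ_le (h : IsSewingGerm P 𝓕 S T m Γ₁ Γ₄ ε₁ ε₄ A)
    (hs : S ≤ s) (hst : s ≤ t) (ht : t ≤ T) (has : a ≤ s)
    (htL : t ≤ a + L) {μ : ℝ} {n : ℕ}
    (hμ : ∀ i, (gridPoint a L s t n (i + 1) : ℝ) - gridPoint a L s t n i ≤ μ) :
    eLpNorm (P[gridSum A a L s t n - gridSum A a L s t (n + 1) | 𝓕 s]) (ENNReal.ofReal m) P ≤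
      ENNReal.ofReal (Γ₁ * μ ^ ε₁ * ((t : ℝ) - s)) := by
  have h1 := h.eLpNorm_condExp_sum_incr_le (gridPoint_mono a L s t n)
    (q := fun i => gridPoint a L s t (n + 1) (2 * i + 1))
    (fun i => hs.trans (le_gridPoint a L s t n i)) (fun i => (gridPoint_le hst n i).trans ht)
    (fun i => (gridPoint_le_midpoint a L s t n i).1)
    (fun i => (gridPoint_le_midpoint a L s t n i).2) hμ (2 ^ n)
  rwa [gridPoint_zero has, gridPoint_two_pow hst htL, ← gridSum_sub_gridSum_succ] at h1

lemma gridSum_zero (A : ℝ≥0 → ℝ≥0 → Ω → EuclideanSpace ℝ (Fin d)) (hst : s ≤ t) (has : a ≤ s)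
    (htL : t ≤ a + L) : gridSum A a L s t 0 = A s t := by
  have h1 : gridPoint a L s t 0 1 = t := gridPoint_two_pow hst htL 0
  simp [gridSum, gridPoint_zero has, h1]

lemma exists_tendsto_gridSum (h : IsSewingGerm P 𝓕 S T m Γ₁ Γ₄ ε₁ ε₄ A)
    (hκ : IsBDGConst.{u} m d κ) (hs : S ≤ s) (hst : s ≤ t) (ht : t ≤ T) (has : a ≤ s)
    (htL : t ≤ a + L) :
    ∃ J : Ω → EuclideanSpace ℝ (Fin d), StronglyMeasurable[𝓕 t] J ∧
      MemLp J (ENNReal.ofReal m) P ∧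
      Filter.Tendsto (fun n => eLpNorm (gridSum A a L s t n - J) (ENNReal.ofReal m) P)
        Filter.atTop (nhds 0) := by
  have hts : 0 ≤ (t : ℝ) - s := sub_nonneg.2 hst
  have hκ0 := hκ.1
  have h1 := h.nonneg₁
  have h4 := h.nonneg₄
  have hhalf : (0 : ℝ) ≤ 1 / 2 := by norm_num
  have hsum : ∀ e : ℝ, 0 < e → Summable fun n : ℕ => ((L : ℝ) * (1 / 2) ^ n) ^ e := fun e he =>
    (hasSum_mul_pow_rpow L.2 hhalf (by norm_num) he).summable
  refine exists_tendsto_eLpNorm_of_summable h.one_le (𝓕.le t)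
    (fun n => h.stronglyMeasurable_gridSum hs hst ht n) (fun n => h.memLp_gridSum hs hst ht n)
    (a := fun n => Γ₁ * ((L : ℝ) * (1 / 2) ^ n) ^ ε₁ * ((t : ℝ) - s) +
        6 * κ * Γ₄ * ((L : ℝ) * (1 / 2) ^ n) ^ ε₄ * Real.sqrt ((t : ℝ) - s))
    (fun n => by positivity) ?_ fun n => ?_
  · exact (((hsum ε₁ h.pos₁).mul_left _).mul_right _).add
      (((hsum ε₄ h.pos₄).mul_left _).mul_right _)
  · refine h.eLpNorm_gridSum_sub_succ_le hκ hs hst ht has htL fun i => ?_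
    refine (gridPoint_sub_le a L s t n i).trans (le_of_eq ?_)
    rw [one_div, inv_pow, div_eq_mul_inv]

/-- Bounds for the limit of the grid sums in terms of a geometric bound on the mesh. -/
lemma bounds_of_tendsto_gridSum (h : IsSewingGerm P 𝓕 S T m Γ₁ Γ₄ ε₁ ε₄ A)
    (hκ : IsBDGConst.{u} m d κ) (hs : S ≤ s) (hst : s ≤ t) (ht : t ≤ T) (has : a ≤ s)
    (htL : t ≤ a + L) {ν ρ : ℝ} (hν : 0 ≤ ν) (hρ : 0 ≤ ρ) (hρ1 : ρ < 1)
    (hμ : ∀ n i, (gridPoint a L s t n (i + 1) : ℝ) - gridPoint a L s t n i ≤ ν * ρ ^ n)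
    {J : Ω → EuclideanSpace ℝ (Fin d)} (hJ : MemLp J (ENNReal.ofReal m) P)
    (hlim : Filter.Tendsto (fun n => eLpNorm (gridSum A a L s t n - J) (ENNReal.ofReal m) P)
      Filter.atTop (nhds 0)) :
    eLpNorm (J - A s t) (ENNReal.ofReal m) P ≤
        ENNReal.ofReal (Γ₁ * (ν ^ ε₁ * (1 - ρ ^ ε₁)⁻¹) * ((t : ℝ) - s) +
          6 * κ * Γ₄ * (ν ^ ε₄ * (1 - ρ ^ ε₄)⁻¹) * Real.sqrt ((t : ℝ) - s)) ∧
      eLpNorm (P[J - A s t | 𝓕 s]) (ENNReal.ofReal m) P ≤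
        ENNReal.ofReal (Γ₁ * (ν ^ ε₁ * (1 - ρ ^ ε₁)⁻¹) * ((t : ℝ) - s)) := by
  have hts : 0 ≤ (t : ℝ) - s := sub_nonneg.2 hst
  have hκ0 := hκ.1
  have h1 := h.nonneg₁
  have h4 := h.nonneg₄
  have hs1 := ((hasSum_mul_pow_rpow hν hρ hρ1 h.pos₁).mul_left Γ₁).mul_right ((t : ℝ) - s)
  have hs4 := ((hasSum_mul_pow_rpow hν hρ hρ1 h.pos₄).mul_left (6 * κ * Γ₄)).mul_right
    (Real.sqrt ((t : ℝ) - s))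
  have hR : ∀ n, MemLp (gridSum A a L s t n) (ENNReal.ofReal m) P := fun n =>
    h.memLp_gridSum hs hst ht n
  have hA := h.memLp s t hs hst ht
  have hlim' : Filter.Tendsto (fun n => eLpNorm ((gridSum A a L s t n - A s t) - (J - A s t))
      (ENNReal.ofReal m) P) Filter.atTop (nhds 0) := by
    simpa only [sub_sub_sub_cancel_right] using hlim
  constructor
  · refine eLpNorm_le_of_tendsto h.one_le (fun n => (hR n).sub hA) (hJ.sub hA) hlim' fun n => ?_
    have h2 := eLpNorm_zero_sub_le_sum h.one_le hR (fun n => by positivity)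
      (hs1.add hs4).summable
      (fun n => h.eLpNorm_gridSum_sub_succ_le hκ hs hst ht has htL (hμ n)) n
    rwa [(hs1.add hs4).tsum_eq, gridSum_zero A hst has htL] at h2
  · refine eLpNorm_condExp_le_of_tendsto h.one_le (fun n => (hR n).sub hA) (hJ.sub hA) hlim'
      fun n => ?_
    have h2 := eLpNorm_condExp_zero_sub_le_sum h.one_le hR (fun n => by positivity) hs1.summable
      (fun n => h.eLpNorm_condExp_gridSum_sub_succ_le hs hst ht has htL (hμ n)) n
    rwa [hs1.tsum_eq, gridSum_zero A hst has htL] at h2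

end Grid

end IsSewingGerm

end Germ

/-! ### Construction, sharp bounds and identification of the sewing -/

section Sewing

variable {Ω : Type u} {mΩ : MeasurableSpace Ω} {d : ℕ}

namespace IsSewingGerm

variable {P : Measure Ω} {𝓕 : Filtration ℝ≥0 mΩ} {S T : ℝ≥0} {m Γ₁ Γ₄ ε₁ ε₄ κ : ℝ}
  {A : ℝ≥0 → ℝ≥0 → Ω → EuclideanSpace ℝ (Fin d)}

/-- Cutting a cell at s is an `incr` at s projected onto the cell. If s lies outside, both sides
reduce to diagonal values of `A`, which vanish almost surely. -/
lemma incr_clamp_ae_eq (h : IsSewingGerm P 𝓕 S T m Γ₁ Γ₄ ε₁ ε₄ A) {x y s : ℝ≥0} (hx : S ≤ x)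
    (hxy : x ≤ y) (hy : y ≤ T) (hs : S ≤ s) (hsT : s ≤ T) :
    A x y - A (min x s) (min y s) - A (max x s) (max y s) =ᵐ[P]
      incr A x (max x (min s y)) y := by
  rcases le_total s x with h1 | h1
  · rw [min_eq_right h1, min_eq_right (h1.trans hxy), max_eq_left h1, max_eq_left (h1.trans hxy),
      min_eq_left (h1.trans hxy), max_eq_left h1, incr]
    filter_upwards [h.diag_ae_eq_zero hs hsT, h.diag_ae_eq_zero hx (hxy.trans hy)] with ω h2 h3
    simp [h2, h3]
  · rcases le_total y s with h2 | h2
    · rw [min_eq_left h1, min_eq_left h2, max_eq_right h1, max_eq_right h2, min_eq_right h2,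
        max_eq_right hxy, incr]
      filter_upwards [h.diag_ae_eq_zero hs hsT, h.diag_ae_eq_zero (hx.trans hxy) hy] with ω h3 h4
      simp [h3, h4]
    · rw [min_eq_left h1, min_eq_right h2, max_eq_right h1, max_eq_left h2, min_eq_left h2,
        max_eq_right h1, incr]

variable [IsProbabilityMeasure P]

/-- The grid sums are asymptotically additive. -/
lemma tendsto_gridSum_add (h : IsSewingGerm P 𝓕 S T m Γ₁ Γ₄ ε₁ ε₄ A)
    (hκ : IsBDGConst.{u} m d κ) {a L r s t : ℝ≥0} (hr : S ≤ r) (hrs : r ≤ s) (hst : s ≤ t)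
    (ht : t ≤ T) (har : a ≤ r) (htL : t ≤ a + L) :
    Filter.Tendsto (fun n => eLpNorm (gridSum A a L r t n - gridSum A a L r s n -
      gridSum A a L s t n) (ENNReal.ofReal m) P) Filter.atTop (nhds 0) := by
  have hrt := hrs.trans hst
  refine tendsto_of_tendsto_of_tendsto_of_le_of_le tendsto_const_nhds
    (tendsto_ofReal_mesh h.pos₁ h.pos₄ L Γ₁ ((t : ℝ) - r)
      (6 * κ * Γ₄ * Real.sqrt ((t : ℝ) - r))) (fun _ => zero_le) fun n => ?_
  have hdec : gridSum A a L r t n - gridSum A a L r s n - gridSum A a L s t n =ᵐ[P]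
      ∑ i ∈ Finset.range (2 ^ n), incr A (gridPoint a L r t n i)
        (max (gridPoint a L r t n i) (min s (gridPoint a L r t n (i + 1))))
        (gridPoint a L r t n (i + 1)) := by
    rw [gridSum, gridSum, gridSum, ← Finset.sum_sub_distrib, ← Finset.sum_sub_distrib]
    have hterm : ∀ i, _ := fun i => h.incr_clamp_ae_eq (s := s)
      (hr.trans (le_gridPoint a L r t n i)) (gridPoint_mono a L r t n i.le_succ)
      ((gridPoint_le hrt n (i + 1)).trans ht) (hr.trans hrs) (hst.trans ht)
    simp only [gridPoint_min hrs hst, gridPoint_max hrs] at hterm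
    filter_upwards [ae_all_iff.2 hterm] with ω hω
    rw [Finset.sum_apply, Finset.sum_apply]
    exact Finset.sum_congr rfl fun i _ => hω i
  have h1 := h.eLpNorm_sum_incr_le hκ (gridPoint_mono a L r t n)
    (q := fun i => max (gridPoint a L r t n i) (min s (gridPoint a L r t n (i + 1))))
    (fun i => hr.trans (le_gridPoint a L r t n i)) (fun i => (gridPoint_le hrt n i).trans ht)
    (fun i => le_max_left _ _)
    (fun i => max_le (gridPoint_mono a L r t n i.le_succ) (min_le_right _ _))
    (μ := L * (1 / 2) ^ n)
    (fun i => (gridPoint_sub_le a L r t n i).trans (le_of_eq (by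
      rw [one_div, inv_pow, div_eq_mul_inv]))) (2 ^ n)
  rw [gridPoint_zero har, gridPoint_two_pow hrt htL, ← eLpNorm_congr_ae hdec] at h1
  exact h1.trans (ENNReal.ofReal_le_ofReal (le_of_eq (by ring)))

/-- A process whose increments are close to the germ is the limit of the grid sums. -/
lemma tendsto_gridSum_of_bounds (h : IsSewingGerm P 𝓕 S T m Γ₁ Γ₄ ε₁ ε₄ A)
    (hκ : IsBDGConst.{u} m d κ) {φ : ℝ≥0 → Ω → EuclideanSpace ℝ (Fin d)}
    (hφ : ∀ t, S ≤ t → t ≤ T → StronglyMeasurable[𝓕 t] (φ t))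
    (hφL : ∀ t, S ≤ t → t ≤ T → MemLp (φ t) (ENNReal.ofReal m) P)
    {C₁ C₄ e₁ e₄ : ℝ} (hC₁ : 0 ≤ C₁) (hC₄ : 0 ≤ C₄) (he₁ : 0 < e₁) (he₄ : 0 < e₄)
    (hb : ∀ s t : ℝ≥0, S ≤ s → s ≤ t → t ≤ T →
      eLpNorm (φ t - φ s - A s t) (ENNReal.ofReal m) P ≤
        ENNReal.ofReal (C₁ * ((t : ℝ) - s) ^ (1 + e₁) + C₄ * ((t : ℝ) - s) ^ (1 / 2 + e₄)))
    (hc : ∀ s t : ℝ≥0, S ≤ s → s ≤ t → t ≤ T →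
      eLpNorm (P[φ t - φ s - A s t | 𝓕 s]) (ENNReal.ofReal m) P ≤
        ENNReal.ofReal (C₁ * ((t : ℝ) - s) ^ (1 + e₁)))
    {s t : ℝ≥0} (hs : S ≤ s) (hst : s ≤ t) (ht : t ≤ T) :
    Filter.Tendsto (fun n => eLpNorm (gridSum A s (t - s) s t n - (φ t - φ s))
      (ENNReal.ofReal m) P) Filter.atTop (nhds 0) := by
  have hts : 0 ≤ (t : ℝ) - s := sub_nonneg.2 hst
  -- The partition estimate takes a single power for the L_m size, so the two are merged; the
  -- conditional bound keeps its own exponent.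
  obtain ⟨C, e, hC, he, hCe⟩ := exists_rpow_add_rpow_le hC₁ hC₄ he₁ he₄ hts
  have htL : t ≤ s + (t - s) := (add_tsub_cancel_of_le hst).ge
  refine tendsto_of_tendsto_of_tendsto_of_le_of_le tendsto_const_nhds
    (tendsto_ofReal_mesh he₁ he (t - s) C₁ ((t : ℝ) - s)
      (2 * κ * (C * Real.sqrt ((t : ℝ) - s)))) (fun _ => zero_le) fun n => ?_
  set p := gridPoint s (t - s) s t n with hp
  have hpm : Monotone p := gridPoint_mono _ _ _ _ n
  have hpS : ∀ i, S ≤ p i := fun i => hs.trans (le_gridPoint _ _ _ _ n i)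
  have hpT : ∀ i, p i ≤ T := fun i => (gridPoint_le hst n i).trans ht
  have hp0 : p 0 = s := gridPoint_zero le_rfl n
  have hpN : p (2 ^ n) = t := gridPoint_two_pow hst htL n
  have hstep : ∀ i, 0 ≤ (p (i + 1) : ℝ) - p i := fun i =>
    sub_nonneg.2 (NNReal.coe_le_coe.2 (hpm i.le_succ))
  have h1 := eLpNorm_sum_partition_le h.two_le hκ (𝓕 := 𝓕) hpm
    (Z := fun i => φ (p (i + 1)) - φ (p i) - A (p i) (p (i + 1))) hC₁ hC he₁.le he.le
    (μ := (t - s : ℝ≥0) * (1 / 2) ^ n)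
    (fun i => (gridPoint_sub_le s (t - s) s t n i).trans (le_of_eq (by
      rw [one_div, inv_pow, div_eq_mul_inv])))
    (fun i => ((hφ _ (hpS _) (hpT _)).sub ((hφ _ (hpS _) (hpT _)).mono
      (𝓕.mono (hpm i.le_succ)))).sub (h.adapted _ _ (hpS _) (hpm i.le_succ) (hpT _)))
    (fun i => ((hφL _ (hpS _) (hpT _)).sub (hφL _ (hpS _) (hpT _))).sub
      (h.memLp _ _ (hpS _) (hpm i.le_succ) (hpT _)))
    (fun i => (hb _ _ (hpS _) (hpm i.le_succ) (hpT _)).trans (ENNReal.ofReal_le_ofReal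
      (hCe _ (hstep i) (gridPoint_sub_le_sub hst n i))))
    (fun i => hc _ _ (hpS _) (hpm i.le_succ) (hpT _)) (2 ^ n)
  have hsum : ∑ i ∈ Finset.range (2 ^ n), (φ (p (i + 1)) - φ (p i) - A (p i) (p (i + 1))) =
      (φ t - φ s) - gridSum A s (t - s) s t n := by
    rw [Finset.sum_sub_distrib, Finset.sum_range_sub (fun i => φ (p i)), hp0, hpN, gridSum]
  rw [hsum, hp0, hpN, eLpNorm_sub_comm] at h1
  exact h1.trans (ENNReal.ofReal_le_ofReal (le_of_eq (by ring)))

/-- Existence of a process close to the germ, with bounds whose exponents are not sharp. -/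
lemma exists_process (h : IsSewingGerm P 𝓕 S T m Γ₁ Γ₄ ε₁ ε₄ A)
    (hκ : IsBDGConst.{u} m d κ) (hST : S ≤ T) :
    ∃ φ : ℝ≥0 → Ω → EuclideanSpace ℝ (Fin d), φ S =ᵐ[P] 0 ∧
      (∀ t, S ≤ t → t ≤ T → StronglyMeasurable[𝓕 t] (φ t)) ∧
      (∀ t, S ≤ t → t ≤ T → MemLp (φ t) (ENNReal.ofReal m) P) ∧
      ∀ s t : ℝ≥0, S ≤ s → s ≤ t → t ≤ T →
        Filter.Tendsto (fun n => eLpNorm (gridSum A s (t - s) s t n - (φ t - φ s))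
          (ENNReal.ofReal m) P) Filter.atTop (nhds 0) := by
  -- One grid of [S, T] serves every t, which makes the limits comparable.
  have hex : ∀ t, S ≤ t → t ≤ T → _ := fun t hSt htT =>
    h.exists_tendsto_gridSum hκ (a := S) (L := T - S) le_rfl hSt htT le_rfl
      (htT.trans (add_tsub_cancel_of_le hST).ge)
  choose! φ hφ hφL hφlim using hex
  have hm1 := h.one_le
  have hne : ENNReal.ofReal m ≠ 0 := (zero_lt_one.trans_le hm1).ne'
  set L := T - S with hL
  have hLT : ∀ t, t ≤ T → t ≤ S + L := fun t ht => ht.trans (add_tsub_cancel_of_le hST).ge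
  have hadd : ∀ s t : ℝ≥0, S ≤ s → s ≤ t → t ≤ T →
      Filter.Tendsto (fun n => eLpNorm (gridSum A S L s t n - (φ t - φ s))
        (ENNReal.ofReal m) P) Filter.atTop (nhds 0) := by
    intro s t hs hst ht
    have h1 := hφlim t (hs.trans hst) ht
    have h2 := hφlim s hs (hst.trans ht)
    have h3 := h.tendsto_gridSum_add hκ le_rfl hs hst ht le_rfl (hLT t ht)
    have h4 := (h1.add h2).add h3
    simp only [add_zero] at h4
    refine tendsto_of_tendsto_of_tendsto_of_le_of_le tendsto_const_nhds h4
      (fun _ => zero_le) fun n => ?_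
    have m1 := (h.memLp_gridSum (a := S) (L := L) le_rfl (hs.trans hst) ht n)
    have m2 := (h.memLp_gridSum (a := S) (L := L) le_rfl hs (hst.trans ht) n)
    have m3 := (h.memLp_gridSum (a := S) (L := L) hs hst ht n)
    have m4 := hφL t (hs.trans hst) ht
    have m5 := hφL s hs (hst.trans ht)
    calc eLpNorm (gridSum A S L s t n - (φ t - φ s)) (ENNReal.ofReal m) P
        = eLpNorm ((gridSum A S L S t n - φ t) - (gridSum A S L S s n - φ s) -
          (gridSum A S L S t n - gridSum A S L S s n - gridSum A S L s t n))
            (ENNReal.ofReal m) P := by congr 1; abel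
      _ ≤ _ := (eLpNorm_sub_le ((m1.sub m4).sub (m2.sub m5)).1 ((m1.sub m2).sub m3).1 hm1).trans
          (add_le_add_left (eLpNorm_sub_le (m1.sub m4).1 (m2.sub m5).1 hm1) _)
  have hρ : Real.sqrt (1 / 2) < 1 := by
    rw [Real.sqrt_lt' one_pos]
    norm_num
  have hbd : ∀ s t : ℝ≥0, S ≤ s → s ≤ t → t ≤ T → _ := fun s t hs hst ht =>
    h.bounds_of_tendsto_gridSum hκ hs hst ht hs (hLT t ht) (Real.sqrt_nonneg _)
      (Real.sqrt_nonneg _) hρ (fun n i => gridPoint_sub_le_sqrt hst n i)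
      ((hφL t (hs.trans hst) ht).sub (hφL s hs (hst.trans ht))) (hadd s t hs hst ht)
  -- The square root in the mesh bound is what halves the exponents.
  have hsq : ∀ x e : ℝ, 0 ≤ x → 0 < e →
      Real.sqrt (x * L) ^ e = Real.sqrt L ^ e * x ^ (e / 2) := by
    intro x e hx he
    rw [Real.sqrt_mul hx, Real.mul_rpow (Real.sqrt_nonneg _) (Real.sqrt_nonneg _), mul_comm,
      Real.sqrt_eq_rpow x, ← Real.rpow_mul hx]
    congr 2
    ring
  have hinv : ∀ e : ℝ, 0 < e → 0 ≤ (1 - Real.sqrt (1 / 2) ^ e)⁻¹ := fun e he =>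
    inv_nonneg.2 (sub_nonneg.2 (Real.rpow_le_one (Real.sqrt_nonneg _) hρ.le he.le))
  have hi1 := hinv ε₁ h.pos₁
  have hi4 := hinv ε₄ h.pos₄
  have hκ0 := hκ.1
  have hΓ1 := h.nonneg₁
  have hΓ4 := h.nonneg₄
  have he1 := h.pos₁
  have he4 := h.pos₄
  have hx1 : ∀ x : ℝ, 0 ≤ x →
      Γ₁ * (Real.sqrt (x * L) ^ ε₁ * (1 - Real.sqrt (1 / 2) ^ ε₁)⁻¹) * x =
        Γ₁ * Real.sqrt L ^ ε₁ * (1 - Real.sqrt (1 / 2) ^ ε₁)⁻¹ * x ^ (1 + ε₁ / 2) := by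
    intro x hx
    rw [hsq x ε₁ hx he1, Real.rpow_add_of_nonneg hx zero_le_one (by positivity), Real.rpow_one]
    ring
  have hx4 : ∀ x : ℝ, 0 ≤ x →
      6 * κ * Γ₄ * (Real.sqrt (x * L) ^ ε₄ * (1 - Real.sqrt (1 / 2) ^ ε₄)⁻¹) * Real.sqrt x =
        6 * κ * Γ₄ * Real.sqrt L ^ ε₄ * (1 - Real.sqrt (1 / 2) ^ ε₄)⁻¹ *
          x ^ (1 / 2 + ε₄ / 2) := by
    intro x hx
    rw [hsq x ε₄ hx he4, Real.rpow_add_of_nonneg hx (by norm_num) (by positivity),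
      Real.sqrt_eq_rpow x]
    ring
  have hzero : φ S =ᵐ[P] 0 := by
    have h1 := h.bounds_of_tendsto_gridSum hκ le_rfl le_rfl hST le_rfl (hLT S hST)
      (Real.sqrt_nonneg _) (Real.sqrt_nonneg _) hρ
      (fun n i => gridPoint_sub_le_sqrt le_rfl n i) (hφL S le_rfl hST) (hφlim S le_rfl hST)
    have h2 := h1.1
    rw [sub_self, Real.sqrt_zero, mul_zero, mul_zero, add_zero, ENNReal.ofReal_zero] at h2
    have h3 := (eLpNorm_eq_zero_iff ((hφL S le_rfl hST).sub
      (h.memLp S S le_rfl le_rfl hST)).1 hne).1 (le_antisymm h2 zero_le)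
    filter_upwards [h3, h.diag_ae_eq_zero le_rfl hST] with ω h3 h4
    simpa [h4] using h3
  refine ⟨φ, hzero, hφ, hφL, fun s t hs hst ht => ?_⟩
  -- Bootstrap: the halved exponents are good enough to switch from the common grid to the dyadic
  -- grid of [s, t].
  refine h.tendsto_gridSum_of_bounds hκ hφ hφL
    (C₁ := Γ₁ * Real.sqrt L ^ ε₁ * (1 - Real.sqrt (1 / 2) ^ ε₁)⁻¹)
    (C₄ := 6 * κ * Γ₄ * Real.sqrt L ^ ε₄ * (1 - Real.sqrt (1 / 2) ^ ε₄)⁻¹)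
    (e₁ := ε₁ / 2) (e₄ := ε₄ / 2) (by positivity) (by positivity) (by positivity) (by positivity)
    (fun s t hs hst ht => ?_) (fun s t hs hst ht => ?_) hs hst ht
  · have hts : 0 ≤ (t : ℝ) - s := sub_nonneg.2 hst
    have h1 := (hbd s t hs hst ht).1
    rwa [hx1 _ hts, hx4 _ hts] at h1
  · have hts : 0 ≤ (t : ℝ) - s := sub_nonneg.2 hst
    have h1 := (hbd s t hs hst ht).2
    rwa [hx1 _ hts] at h1

/-- The sharp bounds for a process whose increments are limits of the grid sums. -/
lemma sewingBounds_of_tendsto (h : IsSewingGerm P 𝓕 S T m Γ₁ Γ₄ ε₁ ε₄ A)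
    (hκ : IsBDGConst.{u} m d κ) {φ : ℝ≥0 → Ω → EuclideanSpace ℝ (Fin d)}
    (hφL : ∀ t, S ≤ t → t ≤ T → MemLp (φ t) (ENNReal.ofReal m) P)
    (hlim : ∀ s t : ℝ≥0, S ≤ s → s ≤ t → t ≤ T →
        Filter.Tendsto (fun n => eLpNorm (gridSum A s (t - s) s t n - (φ t - φ s))
          (ENNReal.ofReal m) P) Filter.atTop (nhds 0)) :
    SewingBounds P 𝓕 S T m ε₁ ε₄ A (Γ₁ * (1 - (2 : ℝ) ^ (-ε₁))⁻¹)
      (Γ₄ * (6 * κ * (1 - (2 : ℝ) ^ (-ε₄))⁻¹ + 1)) φ := by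
  intro s t hs hst ht
  have hts : 0 ≤ (t : ℝ) - s := sub_nonneg.2 hst
  have hκ0 := hκ.1
  have hΓ1 := h.nonneg₁
  have hΓ4 := h.nonneg₄
  have he1 := h.pos₁
  have he4 := h.pos₄
  have htL : t ≤ s + (t - s) := (add_tsub_cancel_of_le hst).ge
  have hL := (hφL t (hs.trans hst) ht).sub (hφL s hs (hst.trans ht))
  have hA := h.memLp s t hs hst ht
  have h1 := h.bounds_of_tendsto_gridSum hκ hs hst ht le_rfl htL hts (ρ := 1 / 2)
    (by norm_num) (by norm_num) (fun n i => (gridPoint_sub_le s (t - s) s t n i).trans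
      (le_of_eq (by rw [one_div, inv_pow, div_eq_mul_inv, NNReal.coe_sub hst]))) hL
    (hlim s t hs hst ht)
  have h2 : ∀ e : ℝ, (1 / 2 : ℝ) ^ e = 2 ^ (-e) := fun e => by
    rw [one_div, Real.inv_rpow zero_le_two, Real.rpow_neg zero_le_two]
  have hinv : ∀ e : ℝ, 0 < e → 0 ≤ (1 - (2 : ℝ) ^ (-e))⁻¹ := fun e he =>
    inv_nonneg.2 (sub_nonneg.2 (Real.rpow_le_one_of_one_le_of_nonpos one_le_two (by linarith)))
  have hi1 := hinv ε₁ he1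
  have hi4 := hinv ε₄ he4
  have hx1 : Γ₁ * (((t : ℝ) - s) ^ ε₁ * (1 - (2 : ℝ) ^ (-ε₁))⁻¹) * ((t : ℝ) - s) =
      Γ₁ * (1 - (2 : ℝ) ^ (-ε₁))⁻¹ * ((t : ℝ) - s) ^ (1 + ε₁) := by
    rw [Real.rpow_add_of_nonneg hts zero_le_one he1.le, Real.rpow_one]
    ring
  have hx4 : 6 * κ * Γ₄ * (((t : ℝ) - s) ^ ε₄ * (1 - (2 : ℝ) ^ (-ε₄))⁻¹) *
      Real.sqrt ((t : ℝ) - s) =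
      6 * κ * Γ₄ * (1 - (2 : ℝ) ^ (-ε₄))⁻¹ * ((t : ℝ) - s) ^ (1 / 2 + ε₄) := by
    rw [Real.rpow_add_of_nonneg hts (by norm_num) he4.le, Real.sqrt_eq_rpow]
    ring
  rw [h2, h2, hx1, hx4] at h1
  rw [abs_of_nonneg hts]
  refine ⟨?_, h1.2⟩
  -- Adding back `A s t` accounts for the `+ 1` in the second constant.
  calc eLpNorm (φ t - φ s) (ENNReal.ofReal m) P
      = eLpNorm ((φ t - φ s - A s t) + A s t) (ENNReal.ofReal m) P := by rw [sub_add_cancel]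
    _ ≤ _ := (eLpNorm_add_le (hL.sub hA).1 hA.1 h.one_le).trans
        (add_le_add h1.1 (h.size s t hs hst ht))
    _ = _ := by
      rw [← ENNReal.ofReal_add (by positivity) (by positivity)]
      congr 1
      ring

/-- Any sewing of a germ has increments which are limits of the grid sums. -/
lemma tendsto_gridSum_of_isSewing (h : IsSewingGerm P 𝓕 S T m Γ₁ Γ₄ ε₁ ε₄ A)
    (hκ : IsBDGConst.{u} m d κ) {ψ : ℝ≥0 → Ω → EuclideanSpace ℝ (Fin d)}
    (hψ : IsSewing P 𝓕 S T m ε₁ ε₄ A ψ) {s t : ℝ≥0} (hs : S ≤ s) (hst : s ≤ t) (ht : t ≤ T) :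
    Filter.Tendsto (fun n => eLpNorm (gridSum A s (t - s) s t n - (ψ t - ψ s))
      (ENNReal.ofReal m) P) Filter.atTop (nhds 0) := by
  obtain ⟨C₁, C₄, hC₁, hC₄, hb⟩ := hψ.bounds
  have hΓ4 := h.nonneg₄
  refine h.tendsto_gridSum_of_bounds hκ hψ.adapted hψ.memLp (C₁ := C₁) (C₄ := C₄ + Γ₄) hC₁
    (by positivity) h.pos₁ h.pos₄ (fun s t hs hst ht => ?_) (fun s t hs hst ht => ?_) hs hst ht
  · have hts : 0 ≤ (t : ℝ) - s := sub_nonneg.2 hst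
    have h1 := (hb s t hs hst ht).1
    rw [abs_of_nonneg hts] at h1
    have hL := (hψ.memLp t (hs.trans hst) ht).sub (hψ.memLp s hs (hst.trans ht))
    refine (eLpNorm_sub_le hL.1 (h.memLp s t hs hst ht).1 h.one_le).trans
      ((add_le_add h1 (h.size s t hs hst ht)).trans ?_)
    rw [← ENNReal.ofReal_add (by positivity) (by positivity)]
    exact ENNReal.ofReal_le_ofReal (le_of_eq (by ring))
  · have h1 := (hb s t hs hst ht).2
    rwa [abs_of_nonneg (sub_nonneg.2 (NNReal.coe_le_coe.2 hst))] at h1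

end IsSewingGerm

end Sewing

theorem theorem2p4 {Ω : Type u} {mΩ : MeasurableSpace Ω} (P : Measure Ω)
    [IsProbabilityMeasure P] [P.IsComplete]
    (𝓕 : Filtration ℝ≥0 mΩ)
    (h_null : ∀ N : Set Ω, P N = 0 → MeasurableSet[𝓕 0] N)
    (d : ℕ) (hd : 1 ≤ d) (m : ℝ) (hm : 2 ≤ m) (S T : ℝ≥0) (hST : S < T)
    (A : ℝ≥0 → ℝ≥0 → Ω → EuclideanSpace ℝ (Fin d))
    (h_adapted : ∀ s t, S ≤ s → s ≤ t → t ≤ T → StronglyMeasurable[𝓕 t] (A s t))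
    (h_memLp : ∀ s t, S ≤ s → s ≤ t → t ≤ T → MemLp (A s t) (ENNReal.ofReal m) P)
    (Γ₁ Γ₄ ε₁ ε₄ : ℝ) (hΓ₁ : 0 ≤ Γ₁) (hΓ₄ : 0 ≤ Γ₄) (hε₁ : 0 < ε₁) (hε₄ : 0 < ε₄)
    (h_cond : ∀ s r t : ℝ≥0, S ≤ s → s ≤ r → r ≤ t → t ≤ T →
      eLpNorm (P[incr A s r t | 𝓕 s]) (ENNReal.ofReal m) P ≤
        ENNReal.ofReal (Γ₁ * |(t : ℝ) - s| ^ (1 + ε₁)))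
    (h_size : ∀ s t : ℝ≥0, S ≤ s → s ≤ t → t ≤ T →
      eLpNorm (A s t) (ENNReal.ofReal m) P ≤
        ENNReal.ofReal (Γ₄ * |(t : ℝ) - s| ^ (1 / 2 + ε₄))) :
    ∃ φ : ℝ≥0 → Ω → EuclideanSpace ℝ (Fin d),
      IsSewing P 𝓕 S T m ε₁ ε₄ A φ ∧
      (∀ ψ : ℝ≥0 → Ω → EuclideanSpace ℝ (Fin d), IsSewing P 𝓕 S T m ε₁ ε₄ A ψ →
        ∀ t, S ≤ t → t ≤ T → ψ t =ᵐ[P] φ t) ∧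
      SewingBounds P 𝓕 S T m ε₁ ε₄ A
        (Γ₁ * (1 - (2 : ℝ) ^ (-ε₁))⁻¹)
        (Γ₄ * (6 * bdgConst.{u} m d * (1 - (2 : ℝ) ^ (-ε₄))⁻¹ + 1)) φ := by
  have hκ := isBDGConst_bdgConst.{u} m hm d
  have h : IsSewingGerm P 𝓕 S T m Γ₁ Γ₄ ε₁ ε₄ A :=
    { two_le := hm
      nonneg₁ := hΓ₁
      nonneg₄ := hΓ₄
      pos₁ := hε₁
      pos₄ := hε₄
      adapted := h_adapted
      memLp := h_memLp
      cond := fun s r t hs hsr hrt ht => by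
        have h1 := h_cond s r t hs hsr hrt ht
        rwa [abs_of_nonneg (sub_nonneg.2 (NNReal.coe_le_coe.2 (hsr.trans hrt)))] at h1
      size := fun s t hs hst ht => by
        have h1 := h_size s t hs hst ht
        rwa [abs_of_nonneg (sub_nonneg.2 (NNReal.coe_le_coe.2 hst))] at h1 }
  obtain ⟨φ, hφ0, hφ, hφL, hlim⟩ := h.exists_process hκ hST.le
  have hb := h.sewingBounds_of_tendsto hκ hφL hlim
  have hinv : ∀ e : ℝ, 0 < e → 0 ≤ (1 - (2 : ℝ) ^ (-e))⁻¹ := fun e he =>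
    inv_nonneg.2 (sub_nonneg.2 (Real.rpow_le_one_of_one_le_of_nonpos one_le_two (by linarith)))
  have hi1 := hinv ε₁ hε₁
  have hi4 := hinv ε₄ hε₄
  have hκ0 := hκ.1
  refine ⟨φ, ⟨hφ0, hφ, hφL, _, _, by positivity, by positivity, hb⟩, fun ψ hψ t hSt htT => ?_, hb⟩
  -- Both increments from S to t are limits of the same grid sums, and both processes vanish at S.
  have h1 := ae_eq_of_tendsto_eLpNorm h.one_le (fun n => h.memLp_gridSum le_rfl hSt htT n)
    ((hψ.memLp t hSt htT).sub (hψ.memLp S le_rfl hST.le))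
    ((hφL t hSt htT).sub (hφL S le_rfl hST.le))
    (h.tendsto_gridSum_of_isSewing hκ hψ le_rfl hSt htT) (hlim S t le_rfl hSt htT)
  filter_upwards [h1, hψ.zero, hφ0] with ω h1 h2 h3
  simpa [h2, h3] using h1
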